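/- Setting. Let $T$ be a finite tree with $n\ge 1$ vertices, and let $\rho>0$. Each edge $e$ has an interval $[w_e^-,w_e^+]$ with $0\le w_e^-\le w_e^+$. A scenario is a choice $s=(w^s_e)_e$ with $w^s_e\in[w^-_e,w^+_e]$; $C$ is the set of scenarios. Broadcasting follows the postal model: a vertex that has the message connects to its receivers one after another, each connection takes time $\rho$, and a receiver $b$ connected by $a$ gets the message $w^s_{a,b}$ time units after the connection is completed (meanwhile $a$ may serve further receivers). For a subtree $T'\ni u$, let $b^s(u,T')$ be the minimum time for $u$ to broadcast to all of $T'$. Let $r^s_{x,y}=b^s(x,T)-b^s(y,T)$. A scenario $s\in C$ is \emph{worst-case for $x$} if $r^s_{x,y}=\max\{r^{s'}_{x,y'} : s'\in C,\ y'\in V(T)\}$ for some $y$. For vertices $a\ne b$, let $O(a,b)$ be the component of $T-a$ containing $b$ (open branch), and $B(a,b)=T-O(a,b)$ (closed branch). A broadcast center under $s$ is a vertex minimizing $b^s(\cdot,T)$; such a vertex $k$ is \emph{prime} if moreover $b^s(k,B(k,u))\ge b^s(u,B(u,k))$ for all neighbours $u$ of $k$. Let $P_{x,y}$ be the edge set of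 the $x$-to-$y$ path, $d_{x,y}=|P_{x,y}|$, and $\tilde w^s_{x,y}=\sum_{e\in P_{x,y}}w^s_e$. Fix $x\in V(T)$ and $c\in C$. For $y\ne x$ the base scenario $\alpha_{x,y}$ has weight $w_e^+$ if $e\in P_{x,y}\cup E(B(y,x))$ and $w_e^-$ otherwise. For a scenario $s$ and a neighbour $v$ of $y$ put $f^s_y(v)=w^s_{y,v}+b^s(v,B(v,y))$. Let $h=h_y$ be the number of neighbours of $y$ in $B(y,x)$, and list them as $u_1,\dots,u_h$ ($u_k=u_{y,k}$) with $f^{\alpha_{x,y}}_y(u_k)$ nonincreasing in $k$ (ties broken arbitrarily). Let $E_k=\{(y,u_k)\}\cup E(B(u_k,y))$. For $1\le j\le h$, $\beta^j_{x,y}$ has weight $w_e^-$ if $e\in\bigcup_{j<k\le h}E_k$, and the weight of $\alpha_{x,y}$ otherwise. Let $\mathcal F=\{c\}\cup\{\beta^j_{x,y}: y\ne x,\ 1\le j\le h_y\}$. Claims. 1. (Finite family.) $\mathcal F$ is a finite set of scenarios, $|\mathcal F|\le n-1$ if $n\ge2$, and $\mathcal F$ contains a worst-case scenario for $x$. If $x$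 is a broadcast center under some worst-case scenario for $x$, then $c$ is worst-case for $x$. If $x$ is not a prime broadcast center under any worst-case scenario for $x$ (condition $(*)$), then some $\beta^j_{x,y}$ is worst-case for $x$, where $y\neq x$ is a prime broadcast center under some worst-case scenario for $x$. 2. (Criterion.) If $$d_{x,y}\,\rho+\tilde w^{\beta^j_{x,y}}_{x,y}+b^{\beta^j_{x,y}}(y,B(y,x))-b^{\beta^j_{x,y}}(y,T)$$ attains its maximum over all $y\ne x$ and $1\le j\le h_y$ at $(y',j')$, then $\beta^{j'}_{x,y'}$ is worst-case for $x$. 3. (Fact 1.) Let $s$ be worst-case for $x$, and let $y\ne x$ be a prime broadcast center under $s$. Let $s'$ agree with $\alpha_{x,y}$ on $P_{x,y}\cup E(O(y,x))$ and with $s$ on all other edges. Then $s'$ is worst-case for $x$, and $y$ is a broadcast center under $s'$. 4. (Fact 2.) Under $(*)$ there are a worst-case scenario $s$ for $x$ and a prime broadcast center $y\ne x$ under $s$ such that $s$ agrees with $\alpha_{x,y}$ on $P_{x,y}\cup E(O(y,x))$. 5. (Facts 3 and 4.) Assume $(*)$, and let $s,y$ be any pair as in 4. Let $\mu$ be the neighbour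 of $y$ in $O(y,x)$. For $0\le j\le h$, let $\gamma^j$ agree with $\alpha_{x,y}$ on $\bigcup_{1\le k\le j}E_k$ and with $s$ elsewhere. Let $Q_0$ be an arrangement of $u_1,\dots,u_h$ with $f^s_y$ nonincreasing. For $1\le j\le h$, let $Q_j$ arise from $Q_{j-1}$ by moving $u_j$ to position $j$ and shifting the entries from position $j$ up to just before the old position of $u_j$ one place to the right. Write $Q_j=(q_{j,1},\dots,q_{j,h})$, and let $\tau_j$ be the least $k$ with $b^{\gamma^j}(y,B(y,x))=k\rho+f_y^{\gamma^j}(q_{j,k})$. Then $\tau_0$ exists, and: - if $w^s_{y,\mu}+b^s(\mu,O(y,x))\ge f^s_y(q_{0,\tau_0})$, then $\beta^{h}_{x,y}$ is worst-case for $x$; - if $w^s_{y,\mu}+b^s(\mu,O(y,x))< f^s_y(q_{0,\tau_0})$, then there is a least $t^*\in\{1,\dots,h\}$ with $\tau_{t^*}=t^*$, and $\beta^{t^*}_{x,y}$ is worst-case for $x$. -/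

import Mathlib

namespace Broadcast

/-- A weight assignment to the edges of the graph `G`. -/
abbrev Weights {V : Type*} (G : SimpleGraph V) := G.edgeSet → ℝ

/-- The set `C` of scenarios: the product of the intervals `[lo e, hi e]` over all edges `e`. -/
def scenarios {V : Type*} {G : SimpleGraph V} (lo hi : Weights G) : Set (Weights G) :=
  {s | ∀ e, s e ∈ Set.Icc (lo e) (hi e)}

open Classical in
/-- The weight of the edge `(a, b)` under `s` (only used when `a` and `b` are adjacent). -/
noncomputable def wt {V : Type*} {G : SimpleGraph V} (s : Weights G) (a b : V) : ℝ :=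
  if h : G.Adj a b then s ⟨s(a, b), h⟩ else 0

/-- A broadcast schedule in the postal model on the subgraph of `G` induced by `S`, with source `u`.
Every vertex `v` of `S` other than `u` gets the message from a neighbour `par v` in `S`.
The sender `par v`, once it has the message, starts at time `call v` to connect to `v`; this takes
`ρ` time units, during which the sender cannot connect to another receiver. The message then
travels along the link for `wt s (par v) v` time units, and the sender is free in the meantime. -/
structure IsSchedule {V : Type*} {G : SimpleGraph V} (ρ : ℝ) (s : Weights G) (u : V) (S : Set V)
    (par : V → V) (call recv : V → ℝ) : Prop where
  source : recv u = 0
  par_mem : ∀ v ∈ S, v ≠ u → par v ∈ S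
  adj : ∀ v ∈ S, v ≠ u → G.Adj (par v) v
  informed : ∀ v ∈ S, v ≠ u → recv (par v) ≤ call v
  delivery : ∀ v ∈ S, v ≠ u → recv v = call v + ρ + wt s (par v) v
  sequential : ∀ v ∈ S, ∀ v' ∈ S, v ≠ u → v' ≠ u → v ≠ v' → par v = par v' →
    call v + ρ ≤ call v' ∨ call v' + ρ ≤ call v

/-- `b_time^s(u, S)`: the minimum time in which `u` can broadcast a message to all other vertices
of the subgraph induced by `S`. -/
noncomputable def bTime {V : Type*} {G : SimpleGraph V} (ρ : ℝ) (s : Weights G) (u : V)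
    (S : Set V) : ℝ :=
  sInf {t | ∃ (par : V → V) (call recv : V → ℝ),
    IsSchedule ρ s u S par call recv ∧ ∀ v ∈ S, recv v ≤ t}

/-- `v` is a broadcast center under `s`. -/
def IsCenter {V : Type*} {G : SimpleGraph V} (ρ : ℝ) (s : Weights G) (v : V) : Prop :=
  ∀ z, bTime ρ s v Set.univ ≤ bTime ρ s z Set.univ

/-- The relative regret `r^s_{x,y}`. -/
noncomputable def regret {V : Type*} {G : SimpleGraph V} (ρ : ℝ) (s : Weights G) (x y : V) : ℝ :=
  bTime ρ s x Set.univ - bTime ρ s y Set.univ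

/-- `s` is a worst-case scenario with respect to `x`: it is a scenario, and for some `y` the value
`r^s_{x,y}` is the maximum regret of `x`. -/
def IsWorstCase {V : Type*} {G : SimpleGraph V} (ρ : ℝ) (lo hi : Weights G) (x : V)
    (s : Weights G) : Prop :=
  s ∈ scenarios lo hi ∧
    ∃ y, IsGreatest {r | ∃ s' ∈ scenarios lo hi, ∃ y', r = regret ρ s' x y'} (regret ρ s x y)

/-- The vertex set of the open branch: the component of `G - x` that contains `y`. -/
def openBranch {V : Type*} (G : SimpleGraph V) (x y : V) : Set V :=
  {z | ∃ p : G.Walk y z, x ∉ p.support}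

/-- The vertex set of the closed branch: all vertices outside the open branch. -/
def closedBranch {V : Type*} (G : SimpleGraph V) (x y : V) : Set V :=
  (openBranch G x y)ᶜ

/-- `k` is a prime broadcast center under `s`. -/
def IsPrimeCenter {V : Type*} {G : SimpleGraph V} (ρ : ℝ) (s : Weights G) (k : V) : Prop :=
  IsCenter ρ s k ∧
    ∀ u, G.Adj k u → bTime ρ s u (closedBranch G u k) ≤ bTime ρ s k (closedBranch G k u)

/-- The set of edges with both endpoints in `S`. -/
def edgesIn {V : Type*} (G : SimpleGraph V) (S : Set V) : Set G.edgeSet :=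
  {e | ∀ v ∈ (e : Sym2 V), v ∈ S}

/-- The set `P_{x,y}` of edges on the `x`-to-`y` path (unique when `G` is a tree). -/
def pathEdges {V : Type*} (G : SimpleGraph V) (x y : V) : Set G.edgeSet :=
  {e | ∃ p : G.Walk x y, p.IsPath ∧ (e : Sym2 V) ∈ p.edges}

/-- The total weight of the edges on the `x`-to-`y` path. -/
noncomputable def pathWeight {V : Type*} {G : SimpleGraph V} (s : Weights G) (x y : V) : ℝ :=
  ∑ᶠ e ∈ pathEdges G x y, s e

open Classical in
/-- The base scenario `α_{x,y}`. -/
noncomputable def baseScenario {V : Type*} {G : SimpleGraph V} (lo hi : Weights G) (x y : V) :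
    Weights G :=
  fun e => if e ∈ pathEdges G x y ∪ edgesIn G (closedBranch G y x) then hi e else lo e

/-- The neighbours of `y` in the closed branch at `y` away from `x`. -/
def branchNbrs {V : Type*} (G : SimpleGraph V) (x y : V) : Set V :=
  {u | G.Adj y u ∧ u ∈ closedBranch G y x}

/-- The number `h` of neighbours of `y` in the closed branch at `y` away from `x`. -/
noncomputable def branchDeg {V : Type*} (G : SimpleGraph V) (x y : V) : ℕ :=
  (branchNbrs G x y).ncard

/-- For a neighbour `u` of `y`: the weight of `(y, u)` plus the time that `u` needs to broadcast
over its side of the edge `(y, u)`. -/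
noncomputable def branchValue {V : Type*} {G : SimpleGraph V} (ρ : ℝ) (s : Weights G)
    (y u : V) : ℝ :=
  wt s y u + bTime ρ s u (closedBranch G u y)

/-- `q 1, ..., q h` lists the neighbours of `y` in the closed branch at `y` away from `x`, each
once, in nonincreasing order of their branch values under `s`. -/
def IsSortedArrangement {V : Type*} {G : SimpleGraph V} (ρ : ℝ) (s : Weights G) (x y : V)
    (q : ℕ → V) : Prop :=
  Set.BijOn q (Set.Icc 1 (branchDeg G x y)) (branchNbrs G x y) ∧
    AntitoneOn (fun k => branchValue ρ s y (q k)) (Set.Icc 1 (branchDeg G x y))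

/-- The edge `(y, u)` together with the edges of the side of `u`. -/
def branchEdges {V : Type*} (G : SimpleGraph V) (y u : V) : Set G.edgeSet :=
  {e | (e : Sym2 V) = s(y, u) ∨ e ∈ edgesIn G (closedBranch G u y)}

open Classical in
/-- The modified base scenario `β^j_{x,y}`, for the arrangement `u 1, ..., u h`. -/
noncomputable def betaScenario {V : Type*} {G : SimpleGraph V} (lo hi : Weights G) (x y : V)
    (u : ℕ → V) (j : ℕ) : Weights G :=
  fun e => if ∃ k, j < k ∧ k ≤ branchDeg G x y ∧ e ∈ branchEdges G y (u k) then lo e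
    else baseScenario lo hi x y e

open Classical in
/-- The scenario `γ^j_{x,y}`, which starts from `γ^0 = s`. -/
noncomputable def gammaScenario {V : Type*} {G : SimpleGraph V} (lo hi : Weights G)
    (s : Weights G) (x y : V) (u : ℕ → V) (j : ℕ) : Weights G :=
  fun e => if ∃ k, 1 ≤ k ∧ k ≤ j ∧ e ∈ branchEdges G y (u k) then baseScenario lo hi x y e
    else s e

open Classical in
/-- The arrangements `Q_j`. To get `Q_{j+1}` from `Q_j`, the entry `u (j + 1)` is moved to position
`j + 1`, and the entries from there up to its old position go one place to the right. -/
noncomputable def shiftSeq {V : Type*} (h : ℕ) (u Q₀ : ℕ → V) : ℕ → ℕ → V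
  | 0 => Q₀
  | j + 1 => fun k =>
      if k ≤ j then shiftSeq h u Q₀ j k
      else if k = j + 1 then u (j + 1)
      else if ∃ l, k ≤ l ∧ l ≤ h ∧ shiftSeq h u Q₀ j l = u (j + 1) then shiftSeq h u Q₀ j (k - 1)
      else shiftSeq h u Q₀ j k

/-- `τ` is the first position in the sequence `q 1, ..., q h` whose branch determines the
broadcast time of `y` over the closed branch at `y` away from `x` under `s`. -/
def IsFirstCritical {V : Type*} {G : SimpleGraph V} (ρ : ℝ) (s : Weights G) (x y : V)
    (q : ℕ → V) (τ : ℕ) : Prop :=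
  IsLeast {k | k ∈ Set.Icc 1 (branchDeg G x y) ∧
    bTime ρ s y (closedBranch G y x) = k * ρ + branchValue ρ s y (q k)} τ

/-- `d_{x,y} ρ + w̃^s_{x,y} + b_time^s(y, closed branch at y away from x) - b_time^s(y, T)`. -/
noncomputable def criterion {V : Type*} {G : SimpleGraph V} (ρ : ℝ) (s : Weights G) (x y : V) :
    ℝ :=
  (pathEdges G x y).ncard * ρ + pathWeight s x y + bTime ρ s y (closedBranch G y x)
    - bTime ρ s y Set.univ

/-- The candidate family: an arbitrary scenario `c`, and all `β^j_{x,y}` with `y ≠ x`, `1 ≤ j ≤ h`,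
where `u y` is the chosen arrangement for `y`. -/
def candidates {V : Type*} {G : SimpleGraph V} (lo hi : Weights G) (x : V) (u : V → ℕ → V)
    (c : Weights G) : Set (Weights G) :=
  {s | s = c ∨ ∃ y, y ≠ x ∧ ∃ j ∈ Set.Icc 1 (branchDeg G x y), s = betaScenario lo hi x y (u y) j}

end Broadcast

open Broadcast

/-! A vertex does best by serving its neighbours in nonincreasing order of branch value. Its
broadcast time is then `callTime`, the maximum over receivers `v` of the number of receivers with
value at least `f v`, times `ρ`, plus `f v` (`bTime_closedBranch`). From there on everything is an
inequality about `callTime`.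

The regret is controlled through `criterion`. From `x` the message has to cross the path to `y`, and
`y` then has to cover its closed branch, so `criterion` is at most the regret in every scenario
(`criterion_le_regret`). If `y` is a prime center the two agree (`criterion_eq_regret`): each vertex
on the path can serve the neighbour toward `y` first, and the rest is finished in time. So, starting
from a worst-case `s` with prime center `y`, any change that does not lower `criterion` at `y` gives
a worst-case scenario again, whether or not `y` stays a center.

Four changes lead to some `β^j`. (1) Raising the path and lowering the rest of the open branch
increases the path weight by some amount, the time of `y` over the tree by no more, and leaves the
closed branch alone. (2) A prime center taken as far from `x` as possible survives (1), or is
replaced by a neighbour nearer to `x`, for which the agreement with the base scenario is inherited.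
(3) If the branch toward `x` is at least as heavy as the critical branch, raising the whole closed
branch does no harm. (4) Otherwise the branches are raised in the order `u 1, u 2, ...` until the
one just raised is first critical, at index `t`. Up to there the tree time grows no faster than the
closed-branch time (`IsRaising.callTime_insert_le`). The branches after `t` may then be lowered: the
first `t` alone keep up the closed-branch time, and the tree time can only drop.

If `x` is a center in some worst case, the maximum regret is `0` and every scenario attains it. -/

namespace Broadcast

/-! ### Branches of a tree in terms of distances -/

variable {V : Type*} {G : SimpleGraph V}

lemma walk_unique (hG : G.IsTree) {a b : V} {p q : G.Walk a b} (hp : p.IsPath) (hq : q.IsPath) :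
    p = q :=
  (hG.existsUnique_path a b).unique hp hq

/-- In a tree every path is a geodesic, so the path from `b` to `z` meets `a` exactly when the
triangle inequality through `a` is an equality. Distances then replace walks in most later
arguments. -/
lemma mem_closedBranch_iff (hG : G.IsTree) {a b z : V} :
    z ∈ closedBranch G a b ↔ G.dist b a + G.dist a z = G.dist b z := by
  classical
  constructor
  · intro h
    by_contra hne
    apply h
    obtain ⟨p, -, hl⟩ := hG.connected.exists_path_of_dist b z
    refine ⟨p, fun ha => hne ?_⟩
    have h1 := congrArg SimpleGraph.Walk.length (p.take_spec ha)
    rw [SimpleGraph.Walk.length_append] at h1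
    have h2 := SimpleGraph.dist_le (p.takeUntil a ha)
    have h3 := SimpleGraph.dist_le (p.dropUntil a ha)
    have h4 := hG.connected.dist_triangle (u := b) (v := a) (w := z)
    omega
  · rintro h ⟨p, hp⟩
    obtain ⟨q, -, hq⟩ := hG.connected.exists_path_of_dist b a
    obtain ⟨r, -, hr⟩ := hG.connected.exists_path_of_dist a z
    have hqr : (q.append r).IsPath := by
      apply SimpleGraph.Walk.isPath_of_length_eq_dist
      rw [SimpleGraph.Walk.length_append]
      omega
    have he' : q.append r = p.bypass := walk_unique hG hqr p.bypass_isPath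
    apply hp
    apply p.support_bypass_subset_support
    rw [← he', SimpleGraph.Walk.mem_support_append_iff]
    exact Or.inl q.end_mem_support

lemma mem_openBranch_iff (hG : G.IsTree) {a b z : V} :
    z ∈ openBranch G a b ↔ G.dist b a + G.dist a z ≠ G.dist b z := by
  rw [Ne, ← mem_closedBranch_iff hG, closedBranch, Set.mem_compl_iff, not_not]

lemma closedBranch_self (a : V) : closedBranch G a a = Set.univ := by
  ext z
  simp only [closedBranch, openBranch, Set.mem_compl_iff, Set.mem_ofPred_eq, Set.mem_univ, iff_true]
  rintro ⟨p, hp⟩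
  exact hp p.start_mem_support

lemma mem_closedBranch_root (a b : V) : a ∈ closedBranch G a b := by
  rintro ⟨p, hp⟩
  exact hp p.end_mem_support

lemma dist_adj_cases (hG : G.IsTree) (z : V) {a v : V} (h : G.Adj a v) :
    G.dist z a = G.dist z v + 1 ∨ G.dist z v = G.dist z a + 1 :=
  hG.dist_eq_dist_add_one_of_adj z h

lemma mem_closedBranch_adj (hG : G.IsTree) {a v z : V} (h : G.Adj a v) :
    z ∈ closedBranch G v a ↔ G.dist z a = G.dist z v + 1 := by
  rw [mem_closedBranch_iff hG, SimpleGraph.dist_eq_one_iff_adj.2 h, G.dist_comm (u := v),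
    G.dist_comm (u := a)]
  omega

/-- Both geodesics, extended by the edge to `y`, are the unique path from `x` to `y`, and so have
the same penultimate vertex. -/
lemma parent_unique (hG : G.IsTree) {x y v w : V} (hv : G.Adj y v) (hw : G.Adj y w)
    (hdv : G.dist x y = G.dist x v + 1) (hdw : G.dist x y = G.dist x w + 1) : v = w := by
  obtain ⟨p, hp, hpl⟩ := hG.connected.exists_path_of_dist x v
  obtain ⟨q, hq, hql⟩ := hG.connected.exists_path_of_dist x w
  have h1 : (p.concat hv.symm).IsPath :=
    SimpleGraph.Walk.isPath_of_length_eq_dist _ (by rw [SimpleGraph.Walk.length_concat]; omega)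
  have h2 : (q.concat hw.symm).IsPath :=
    SimpleGraph.Walk.isPath_of_length_eq_dist _ (by rw [SimpleGraph.Walk.length_concat]; omega)
  have he := walk_unique hG h1 h2
  have := congrArg SimpleGraph.Walk.penultimate he
  simpa using this

lemma exists_parent (hG : G.IsTree) {x y : V} (h : y ≠ x) :
    ∃ v, G.Adj y v ∧ G.dist x y = G.dist x v + 1 := by
  obtain ⟨p, hp, hpl⟩ := hG.connected.exists_path_of_dist y x
  cases p with
  | nil => exact absurd rfl h
  | @cons _ v _ hv q =>
    refine ⟨v, hv, ?_⟩
    rw [SimpleGraph.Walk.length_cons] at hpl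
    have h1 := SimpleGraph.dist_le q
    rw [G.dist_comm (u := x), G.dist_comm (u := x)]
    have h2 := dist_adj_cases hG x hv
    rw [G.dist_comm (u := x), G.dist_comm (u := x)] at h2
    omega

lemma mem_openBranch_adj_iff (hG : G.IsTree) {x y v : V} (h : G.Adj y v) :
    v ∈ openBranch G y x ↔ G.dist x y = G.dist x v + 1 := by
  rw [mem_openBranch_iff hG, SimpleGraph.dist_eq_one_iff_adj.2 h]
  have := dist_adj_cases hG x h
  omega

lemma mem_closedBranch_adj_iff (hG : G.IsTree) {x y v : V} (h : G.Adj y v) :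
    v ∈ closedBranch G y x ↔ G.dist x v = G.dist x y + 1 := by
  rw [mem_closedBranch_iff hG, SimpleGraph.dist_eq_one_iff_adj.2 h]
  exact eq_comm

lemma openBranch_eq_of_mem {x y v : V} (h : v ∈ openBranch G y x) :
    openBranch G y x = openBranch G y v := by
  obtain ⟨p, hp⟩ := h
  ext z
  constructor
  · rintro ⟨q, hq⟩
    refine ⟨p.reverse.append q, ?_⟩
    simp [hp, hq]
  · rintro ⟨q, hq⟩
    refine ⟨p.append q, ?_⟩
    simp [hp, hq]

lemma closedBranch_eq_of_mem {x y v : V} (h : v ∈ openBranch G y x) :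
    closedBranch G y x = closedBranch G y v := by
  rw [closedBranch, closedBranch, openBranch_eq_of_mem h]

lemma openBranch_eq_closedBranch (hG : G.IsTree) {y v : V} (h : G.Adj y v) :
    openBranch G y v = closedBranch G v y := by
  ext z
  rw [mem_openBranch_iff hG, mem_closedBranch_adj hG h, SimpleGraph.dist_eq_one_iff_adj.2 h.symm,
    G.dist_comm (u := y), G.dist_comm (u := v)]
  have := dist_adj_cases hG z h
  omega

lemma root_notMem_closedBranch (hG : G.IsTree) {a v : V} (h : G.Adj a v) :
    a ∉ closedBranch G v a := by
  rw [mem_closedBranch_adj hG h]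
  simp

/-- Children of `a` in the branch `closedBranch G a p`, where `p = a` or `p` is a neighbour. -/
lemma exists_child (hG : G.IsTree) {a p z : V} (hp : p = a ∨ G.Adj a p)
    (hz : z ∈ closedBranch G a p) (hza : z ≠ a) :
    ∃ v, G.Adj a v ∧ v ≠ p ∧ z ∈ closedBranch G v a := by
  obtain ⟨v, hv, hd⟩ := exists_parent hG (x := z) (y := a) hza.symm
  refine ⟨v, hv, ?_, (mem_closedBranch_adj hG hv).2 hd⟩
  rintro rfl
  rcases hp with rfl | hp
  · exact hv.ne rfl
  · rw [mem_closedBranch_adj hG hp.symm] at hz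
    omega

lemma child_unique (hG : G.IsTree) {a v w z : V} (hv : G.Adj a v) (hw : G.Adj a w)
    (hzv : z ∈ closedBranch G v a) (hzw : z ∈ closedBranch G w a) : v = w :=
  parent_unique hG hv hw ((mem_closedBranch_adj hG hv).1 hzv) ((mem_closedBranch_adj hG hw).1 hzw)

lemma closedBranch_child_subset (hG : G.IsTree) {a p v : V} (hp : p = a ∨ G.Adj a p)
    (hv : G.Adj a v) (hvp : v ≠ p) : closedBranch G v a ⊆ closedBranch G a p := by
  intro z hz
  rcases hp with rfl | hp
  · rw [closedBranch_self]; trivial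
  · rw [mem_closedBranch_adj hG hp.symm]
    rcases dist_adj_cases hG z hp with h | h
    · exact absurd (parent_unique hG hv hp ((mem_closedBranch_adj hG hv).1 hz) h) hvp
    · exact h

/-- The only edge leaving the branch at `v` away from its neighbour `a` goes to `a`. -/
lemma eq_of_adj_of_notMem (hG : G.IsTree) {a v z w : V} (hv : G.Adj a v)
    (hz : z ∈ closedBranch G v a) (hw : w ∉ closedBranch G v a) (h : G.Adj z w) :
    z = v ∧ w = a := by
  rw [mem_closedBranch_adj hG hv] at hz hw
  have h1 := dist_adj_cases hG w hv
  have h2 := dist_adj_cases hG a h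
  have h3 := dist_adj_cases hG v h
  have h1' : G.dist w v = G.dist w a + 1 := by omega
  rw [G.dist_comm (u := z), G.dist_comm (u := z)] at hz
  rw [G.dist_comm (u := w), G.dist_comm (u := w)] at h1'
  -- Otherwise `z` has a neighbour `t` nearer to `v`. Both `t` and `w` would then be nearer to `a`
  -- than `z` is, hence equal, although `w` is farther from `v` than `z` is.
  have hzv : z = v := by
    by_contra hne
    obtain ⟨t, ht, htd⟩ := exists_parent hG (x := v) (y := z) hne
    have hta : G.dist a z = G.dist a t + 1 := by
      have := hG.connected.dist_triangle (u := a) (v := v) (w := t)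
      have h5 := dist_adj_cases hG a ht
      rw [SimpleGraph.dist_eq_one_iff_adj.2 hv] at this
      omega
    have := parent_unique hG ht h hta (by omega)
    subst this
    omega
  refine ⟨hzv, ?_⟩
  subst hzv
  have h0 := G.dist_self (v := z)
  have : G.dist a w = 0 := by omega
  exact ((hG.connected.dist_eq_zero_iff).1 this).symm

/-! ### Edge sets of branches and paths -/

section Edges

lemma edgesIn_mono {S T : Set V} (h : S ⊆ T) : edgesIn G S ⊆ edgesIn G T :=
  fun _ he v hv => h (he v hv)

lemma branchEdges_disjoint (hG : G.IsTree) {y v w : V} (hv : G.Adj y v) (hw : G.Adj y w)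
    (hvw : v ≠ w) {e : G.edgeSet} (h : e ∈ branchEdges G y v) : e ∉ branchEdges G y w := by
  intro h'
  have key : ∀ z, z ≠ y → z ∈ (e : Sym2 V) → ∀ u, G.Adj y u → e ∈ branchEdges G y u →
      z ∈ closedBranch G u y := by
    intro z hz hze u hu he
    rcases he with he | he
    · rw [he, Sym2.mem_iff] at hze
      rcases hze with rfl | rfl
      · exact absurd rfl hz
      · exact mem_closedBranch_root _ _
    · exact he z hze
  obtain ⟨z, hz, hze⟩ : ∃ z, z ≠ y ∧ z ∈ (e : Sym2 V) := by
    rcases h with h | h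
    · exact ⟨v, hv.ne', by rw [h]; simp⟩
    · obtain ⟨⟨a, b⟩, hab⟩ := e
      refine ⟨a, ?_, by simp⟩
      rintro rfl
      exact root_notMem_closedBranch hG hv (h a (by simp))
  exact hvw (child_unique hG hv hw (key z hz hze v hv h) (key z hz hze w hw h'))

lemma pathEdges_self (hG : G.IsTree) (x : V) : pathEdges G x x = ∅ := by
  ext e
  simp only [pathEdges, Set.mem_ofPred_eq, Set.mem_empty_iff_false, iff_false]
  rintro ⟨p, hp, he⟩
  rw [walk_unique hG hp SimpleGraph.Walk.IsPath.nil] at he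
  simp at he

lemma pathEdges_subset_openBranch (hG : G.IsTree) {x y v : V}
    (hvo : v ∈ openBranch G y x) : pathEdges G x v ⊆ edgesIn G (openBranch G y x) := by
  classical
  rintro e ⟨p, hp, he⟩ z hz
  have hyp : y ∉ p.support := by
    obtain ⟨q, hq⟩ := hvo
    rw [walk_unique hG hp q.bypass_isPath]
    exact fun h => hq (q.support_bypass_subset_support h)
  have hzp : z ∈ p.support := by
    obtain ⟨⟨a, b⟩, hab⟩ := e
    rcases Sym2.mem_iff.1 hz with rfl | rfl
    · exact p.fst_mem_support_of_mem_edges he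
    · exact p.snd_mem_support_of_mem_edges he
  exact ⟨p.takeUntil z hzp, fun h => hyp (p.support_takeUntil_subset_support hzp h)⟩

lemma pathEdges_eq_insert (hG : G.IsTree) {x y v : V} (hv : G.Adj y v)
    (hvo : v ∈ openBranch G y x) :
    pathEdges G x y = insert ⟨s(y, v), hv⟩ (pathEdges G x v) := by
  classical
  obtain ⟨p, hp, hpl⟩ := hG.connected.exists_path_of_dist x v
  have hd := (mem_openBranch_adj_iff hG hv).1 hvo
  have h1 : (p.concat hv.symm).IsPath :=
    SimpleGraph.Walk.isPath_of_length_eq_dist _ (by rw [SimpleGraph.Walk.length_concat]; omega)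
  have key : ∀ {w : V} {q : G.Walk x w}, q.IsPath → ∀ e : G.edgeSet,
      e ∈ pathEdges G x w ↔ (e : Sym2 V) ∈ q.edges := by
    intro w q hq e
    constructor
    · rintro ⟨r, hr, he⟩
      rwa [walk_unique hG hr hq] at he
    · exact fun he => ⟨q, hq, he⟩
  ext e
  rw [key h1, Set.mem_insert_iff, key hp]
  simp only [SimpleGraph.Walk.edges_concat, Subtype.ext_iff,
    List.mem_append, List.concat_eq_append, List.mem_singleton, Sym2.eq_swap (a := v)]
  exact or_comm

lemma edge_notMem_pathEdges (hG : G.IsTree) {x y v : V} (hv : G.Adj y v)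
    (hvo : v ∈ openBranch G y x) : (⟨s(y, v), hv⟩ : G.edgeSet) ∉ pathEdges G x v := by
  intro h
  have := pathEdges_subset_openBranch hG hvo h y (by simp)
  exact mem_closedBranch_root y x this

/-- The path to `v` already lies in the open branch, so the only edge added is `(y, v)`. The region
changed by the first transformation is thus a single branch at `y`. -/
lemma pathEdges_union_edgesIn (hG : G.IsTree) {x y v : V} (hv : G.Adj y v)
    (hvo : v ∈ openBranch G y x) :
    pathEdges G x y ∪ edgesIn G (openBranch G y x) = branchEdges G y v := by
  have h1 := pathEdges_subset_openBranch hG hvo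
  rw [pathEdges_eq_insert hG hv hvo, Set.insert_union, Set.union_eq_self_of_subset_left h1,
    openBranch_eq_of_mem hvo, openBranch_eq_closedBranch hG hv]
  ext e
  simp [branchEdges, Subtype.ext_iff]

lemma pathEdges_subset_branchEdges (hG : G.IsTree) {x y v : V} (hv : G.Adj y v)
    (hvo : v ∈ openBranch G y x) : pathEdges G x y ⊆ branchEdges G y v := by
  rw [← pathEdges_union_edgesIn hG hv hvo]
  exact Set.subset_union_left

lemma branchEdges_subset_edgesIn (hG : G.IsTree) {a p v : V} (hp : p = a ∨ G.Adj a p)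
    (hv : G.Adj a v) (hvp : v ≠ p) : branchEdges G a v ⊆ edgesIn G (closedBranch G a p) := by
  have hsub := closedBranch_child_subset hG hp hv hvp
  rintro e (he | he)
  · intro z hz
    rw [he, Sym2.mem_iff] at hz
    rcases hz with rfl | rfl
    · exact mem_closedBranch_root _ _
    · exact hsub (mem_closedBranch_root _ _)
  · exact edgesIn_mono hsub he

end Edges

end Broadcast

namespace Broadcast

/-! ### Optimal sequential calls from one vertex -/

section CallTime

variable {V : Type*}

/-- The optimal completion time of a vertex that informs the receivers in `N` one after another,
where each connection takes time `ρ` and `v` needs time `f v` after its connection is completed. -/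
noncomputable def callTime (ρ : ℝ) (N : Finset V) (f : V → ℝ) : ℝ :=
  N.fold max 0 fun v => ((N.filter fun w => f v ≤ f w).card : ℝ) * ρ + f v

variable {ρ : ℝ} {N M : Finset V} {f g : V → ℝ}

lemma callTime_le_iff {t : ℝ} : callTime ρ N f ≤ t ↔
    0 ≤ t ∧ ∀ v ∈ N, ((N.filter fun w => f v ≤ f w).card : ℝ) * ρ + f v ≤ t :=
  Finset.fold_max_le _

lemma callTime_nonneg : 0 ≤ callTime ρ N f := (callTime_le_iff.1 le_rfl).1

/-- The receiver of least value in `A` is counted together with all of `A`. Nearly all lower bounds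
on `callTime` below are instances of this one, with a suitable `A` and `θ`. -/
lemma card_mul_add_le_callTime (hρ : 0 ≤ ρ) {A : Finset V} {θ : ℝ} (hA : A ⊆ N)
    (hne : A.Nonempty) (hθ : ∀ w ∈ A, θ ≤ f w) : (A.card : ℝ) * ρ + θ ≤ callTime ρ N f := by
  obtain ⟨v, hv, hmin⟩ := A.exists_min_image f hne
  have h1 := (callTime_le_iff.1 (le_refl (callTime ρ N f))).2 v (hA hv)
  have h2 : A.card ≤ (N.filter fun w => f v ≤ f w).card :=
    Finset.card_le_card fun w hw => Finset.mem_filter.2 ⟨hA hw, hmin w hw⟩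
  have h3 : (A.card : ℝ) * ρ ≤ ((N.filter fun w => f v ≤ f w).card : ℝ) * ρ := by gcongr
  linarith [hθ v hv]

lemma add_le_callTime (hρ : 0 ≤ ρ) {v : V} (hv : v ∈ N) : ρ + f v ≤ callTime ρ N f := by
  have := card_mul_add_le_callTime (f := f) (θ := f v) hρ (Finset.singleton_subset_iff.2 hv)
    (Finset.singleton_nonempty v) (by simp)
  simpa using this

lemma callTime_mono (hρ : 0 ≤ ρ) (hNM : N ⊆ M) (h : ∀ v ∈ N, f v ≤ g v) :
    callTime ρ N f ≤ callTime ρ M g := by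
  refine callTime_le_iff.2 ⟨callTime_nonneg, fun v hv => ?_⟩
  refine card_mul_add_le_callTime hρ ((Finset.filter_subset _ _).trans hNM)
    ⟨v, by simp [hv]⟩ fun w hw => ?_
  rw [Finset.mem_filter] at hw
  exact hw.2.trans (h w hw.1)

lemma callTime_congr (hρ : 0 ≤ ρ) (h : ∀ v ∈ N, f v = g v) :
    callTime ρ N f = callTime ρ N g :=
  le_antisymm (callTime_mono hρ subset_rfl fun v hv => (h v hv).le)
    (callTime_mono hρ subset_rfl fun v hv => (h v hv).ge)

lemma callTime_le_add (hρ : 0 ≤ ρ) {c : ℝ} (hc : 0 ≤ c) (h : ∀ v ∈ N, g v ≤ f v + c) :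
    callTime ρ N g ≤ callTime ρ N f + c := by
  refine callTime_le_iff.2 ⟨add_nonneg callTime_nonneg hc, fun v hv => ?_⟩
  have := card_mul_add_le_callTime (f := f) (θ := g v - c) hρ
    (Finset.filter_subset (fun w => g v ≤ g w) N) ⟨v, by simp [hv]⟩ fun w hw => by
      rw [Finset.mem_filter] at hw
      linarith [h w hw.1]
  linarith

/-- Calling `m` first delays all the others by `ρ`. -/
lemma callTime_insert_le [DecidableEq V] (hρ : 0 ≤ ρ) {m : V} :
    callTime ρ (insert m N) f ≤ ρ + max (f m) (callTime ρ N f) := by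
  have h0 : 0 ≤ callTime ρ N f := callTime_nonneg
  refine callTime_le_iff.2 ⟨by have := le_max_right (f m) (callTime ρ N f); linarith,
    fun v hv => ?_⟩
  have hcard : (((insert m N).filter fun w => f v ≤ f w).card : ℝ) ≤
      ((N.filter fun w => f v ≤ f w).card : ℝ) + 1 := by
    rw [Finset.filter_insert]
    split_ifs
    · exact_mod_cast Finset.card_insert_le _ _
    · simp
  have hmul := mul_le_mul_of_nonneg_right hcard hρ
  rcases (N.filter fun w => f v ≤ f w).eq_empty_or_nonempty with he | hne
  · have hvm : v = m := by
      rcases Finset.mem_insert.1 hv with h | h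
      · exact h
      · exact absurd he (Finset.Nonempty.ne_empty ⟨v, by simp [h]⟩)
    rw [he] at hmul
    have := le_max_left (f m) (callTime ρ N f)
    subst hvm
    simp only [Finset.card_empty, Nat.cast_zero, zero_add, one_mul] at hmul
    linarith
  · have h1 := card_mul_add_le_callTime (f := f) (θ := f v) hρ (Finset.filter_subset _ N) hne
      fun w hw => (Finset.mem_filter.1 hw).2
    have := le_max_right (f m) (callTime ρ N f)
    linarith

/-- Nonempty `N` and nonnegative values rule out that the maximum is only the default `0` of the
fold. -/
lemma exists_callTime_eq (hN : N.Nonempty) (hρ : 0 ≤ ρ) (hf : ∀ v ∈ N, 0 ≤ f v) :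
    ∃ v ∈ N, callTime ρ N f = ((N.filter fun w => f v ≤ f w).card : ℝ) * ρ + f v := by
  by_contra! hne
  have hlt : ∀ v ∈ N, ((N.filter fun w => f v ≤ f w).card : ℝ) * ρ + f v < callTime ρ N f :=
    fun v hv => lt_of_le_of_ne ((callTime_le_iff.1 le_rfl).2 v hv) (hne v hv).symm
  obtain ⟨v, hv⟩ := hN
  have h0 : (0 : ℝ) < callTime ρ N f := lt_of_le_of_lt (by have := hf v hv; positivity) (hlt v hv)
  have : callTime ρ N f < callTime ρ N f := (Finset.fold_max_lt _).2 ⟨h0, hlt⟩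
  exact lt_irrefl _ this

/-- Positions for the receivers in which larger values come first. -/
lemma exists_rank [Fintype V] (N : Finset V) (f : V → ℝ) :
    ∃ p : V → ℕ, Set.InjOn p N ∧
      ∀ v ∈ N, 1 ≤ p v ∧ p v ≤ (N.filter fun w => f v ≤ f w).card := by
  classical
  let e := Fintype.equivFin V
  -- The second component breaks ties, so ranks are distinct. Vertices with smaller or equal key
  -- have value at least `f v`, which bounds the rank.
  let key : V → ℝ ×ₗ Fin (Fintype.card V) := fun v => toLex (-f v, e v)
  have hkey : Function.Injective key := fun v w h => by
    have h1 : (-f v, e v) = (-f w, e w) := toLex.injective h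
    exact e.injective (congrArg Prod.snd h1)
  refine ⟨fun v => (N.filter fun w => key w ≤ key v).card, ?_, fun v hv => ⟨?_, ?_⟩⟩
  · have key1 : ∀ v ∈ N, ∀ w ∈ N, key v < key w →
        (N.filter fun z => key z ≤ key v).card < (N.filter fun z => key z ≤ key w).card := by
      intro v _ w hw h
      refine Finset.card_lt_card (Finset.ssubset_iff_of_subset ?_ |>.2 ⟨w, ?_, ?_⟩)
      · intro z hz
        rw [Finset.mem_filter] at hz ⊢
        exact ⟨hz.1, hz.2.trans h.le⟩
      · simp [hw]
      · simp [h]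
    intro v hv w hw h
    by_contra hne
    rcases lt_or_gt_of_ne (hkey.ne hne) with h' | h'
    · exact (key1 v hv w hw h').ne h
    · exact (key1 w hw v hv h').ne' h
  · exact Finset.card_pos.2 ⟨v, by simp [hv]⟩
  · refine Finset.card_le_card fun w hw => ?_
    rw [Finset.mem_filter] at hw ⊢
    refine ⟨hw.1, ?_⟩
    have h := hw.2
    rw [Prod.Lex.le_iff] at h
    rcases h with h | h
    · have : -f w < -f v := h
      linarith
    · have : -f w = -f v := h.1
      linarith

/-- Nonnegative start times of jobs of length `ρ` that do not overlap. -/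
lemma card_sub_one_mul_le (hρ : 0 < ρ) (h0 : ∀ v ∈ N, 0 ≤ f v)
    (hsep : ∀ v ∈ N, ∀ w ∈ N, v ≠ w → f v + ρ ≤ f w ∨ f w + ρ ≤ f v) {v : V} (hv : v ∈ N) :
    (((N.filter fun w => f w ≤ f v).card : ℝ) - 1) * ρ ≤ f v := by
  -- Cut time into windows of length `ρ`. Start times at least `ρ` apart fall into different
  -- windows, and those up to `f v` use only windows `0` to `⌊f v / ρ⌋`.
  have hcard : (N.filter fun w => f w ≤ f v).card ≤ (Finset.range (⌊f v / ρ⌋₊ + 1)).card := by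
    refine Finset.card_le_card_of_injOn (fun w => ⌊f w / ρ⌋₊) ?_ ?_
    · intro w hw
      rw [Finset.mem_coe, Finset.mem_filter] at hw
      rw [Finset.mem_coe, Finset.mem_range, Nat.lt_succ_iff]
      exact Nat.floor_le_floor (by have := hw.2; gcongr)
    · intro w hw z hz h
      rw [Finset.mem_coe, Finset.mem_filter] at hw hz
      by_contra hne
      have key : ∀ a ∈ N, ∀ b ∈ N, f a + ρ ≤ f b → ⌊f a / ρ⌋₊ < ⌊f b / ρ⌋₊ := by
        intro a ha b hb hab
        rw [← Nat.succ_le_iff, Nat.succ_eq_add_one,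
          ← Nat.floor_add_one (by have := h0 a ha; positivity)]
        refine Nat.floor_le_floor ?_
        rw [div_add_one hρ.ne']
        gcongr
      rcases hsep w hw.1 z hz.1 hne with h' | h'
      · exact (key w hw.1 z hz.1 h').ne h
      · exact (key z hz.1 w hw.1 h').ne' h
  rw [Finset.card_range] at hcard
  have h1 : ((N.filter fun w => f w ≤ f v).card : ℝ) - 1 ≤ f v / ρ := by
    have h2 : ((N.filter fun w => f w ≤ f v).card : ℝ) ≤ (⌊f v / ρ⌋₊ : ℝ) + 1 := by
      exact_mod_cast hcard
    have h3 := Nat.floor_le (a := f v / ρ) (by have := h0 v hv; positivity)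
    linarith
  rwa [le_div_iff₀ hρ] at h1

end CallTime

/-! ### The recursion for broadcast times along branches -/

section Recursion

variable {V : Type*} {G : SimpleGraph V} {ρ : ℝ} {s : Weights G}

lemma wt_nonneg (hs : ∀ e, 0 ≤ s e) (a b : V) : 0 ≤ wt s a b := by
  unfold wt
  split_ifs
  · exact hs _
  · exact le_rfl

lemma wt_of_adj {a b : V} (h : G.Adj a b) : wt s a b = s ⟨s(a, b), h⟩ := dif_pos h

lemma wt_comm (a b : V) : wt s a b = wt s b a := by
  by_cases h : G.Adj a b
  · rw [wt_of_adj h, wt_of_adj h.symm]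
    exact congrArg s (Subtype.ext Sym2.eq_swap)
  · rw [wt, wt, dif_neg h, dif_neg fun h' => h h'.symm]

/-- The times within which `u` can broadcast over `S`. -/
def broadcastTimes (ρ : ℝ) (s : Weights G) (u : V) (S : Set V) : Set ℝ :=
  {t | ∃ (par : V → V) (call recv : V → ℝ),
    IsSchedule ρ s u S par call recv ∧ ∀ v ∈ S, recv v ≤ t}

variable [Fintype V]

open Classical in
/-- The neighbours of `a` other than `p`. -/
noncomputable def nbrs (G : SimpleGraph V) (a p : V) : Finset V :=
  Finset.univ.filter fun v => G.Adj a v ∧ v ≠ p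

@[simp] lemma mem_nbrs {a p v : V} : v ∈ nbrs G a p ↔ G.Adj a v ∧ v ≠ p := by
  simp [nbrs]

/-- The edge `(a, v)` is the only way into the branch at `v`, so inside the branch the schedule is a
broadcast from `v`, with the clock reset to the arrival of the message at `v`. -/
lemma recv_restrict (hG : G.IsTree) (hρ : 0 < ρ) (hs : ∀ e, 0 ≤ s e) {a p v : V}
    (hp : p = a ∨ G.Adj a p) {par : V → V} {call recv : V → ℝ}
    (h : IsSchedule ρ s a (closedBranch G a p) par call recv) (hv : G.Adj a v) (hvp : v ≠ p) :
    par v = a ∧ IsSchedule ρ s v (closedBranch G v a) par (fun z => call z - recv v)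
      (fun z => recv z - recv v) := by
  have hsub := closedBranch_child_subset hG hp hv hvp
  have hane : ∀ z ∈ closedBranch G v a, z ≠ a := by
    rintro z hz rfl
    exact root_notMem_closedBranch hG hv hz
  have hin : ∀ z ∈ closedBranch G v a, z ≠ v → par z ∈ closedBranch G v a := by
    intro z hz hzv
    by_contra hn
    exact hzv (eq_of_adj_of_notMem hG hv hz hn (h.adj z (hsub hz) (hane z hz)).symm).1
  have hlt : ∀ z ∈ closedBranch G v a, recv (par z) < recv z := by
    intro z hz
    have h1 := h.informed z (hsub hz) (hane z hz)
    have h2 := h.delivery z (hsub hz) (hane z hz)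
    have h3 := wt_nonneg hs (par z) z
    linarith
  have hvv : v ∈ closedBranch G v a := mem_closedBranch_root _ _
  refine ⟨?_, ⟨by simp, hin, ?_, ?_, ?_, ?_⟩⟩
  -- If `v` were informed from inside its branch, all senders for the branch would lie in it. A
  -- vertex of the branch with least receiving time has a strictly earlier sender, a contradiction.
  · have hnot : par v ∉ closedBranch G v a := by
      intro hmem
      obtain ⟨z, hz, hmin⟩ := Set.exists_min_image (closedBranch G v a) recv (Set.toFinite _)
        ⟨v, hvv⟩
      have : par z ∈ closedBranch G v a := by
        by_cases hzv : z = v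
        · rwa [hzv]
        · exact hin z hz hzv
      exact (hlt z hz).not_ge (hmin _ this)
    exact (eq_of_adj_of_notMem hG hv hvv hnot (h.adj v (hsub hvv) (hane v hvv)).symm).2
  · exact fun z hz _ => h.adj z (hsub hz) (hane z hz)
  · intro z hz _
    have := h.informed z (hsub hz) (hane z hz)
    simpa using this
  · intro z hz _
    have := h.delivery z (hsub hz) (hane z hz)
    linarith
  · intro z hz z' hz' _ _ hne hpar
    have := h.sequential z (hsub hz) z' (hsub hz') (hane z hz) (hane z' hz') hne hpar
    rcases this with h | h
    · left; linarith
    · right; linarith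

lemma exists_of_mem_broadcastTimes (hG : G.IsTree) (hρ : 0 < ρ) (hs : ∀ e, 0 ≤ s e) {a p : V}
    (hp : p = a ∨ G.Adj a p) {t : ℝ} (ht : t ∈ broadcastTimes ρ s a (closedBranch G a p)) :
    ∃ τ : V → ℝ, (∀ v ∈ nbrs G a p, τ v ∈ broadcastTimes ρ s v (closedBranch G v a)) ∧
      callTime ρ (nbrs G a p) (fun v => wt s a v + τ v) ≤ t := by
  obtain ⟨par, call, recv, h, ht⟩ := ht
  have hres : ∀ v ∈ nbrs G a p, _ := fun v hv =>
    recv_restrict hG hρ hs hp h (mem_nbrs.1 hv).1 (mem_nbrs.1 hv).2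
  have hsub : ∀ v ∈ nbrs G a p, closedBranch G v a ⊆ closedBranch G a p := fun v hv =>
    closedBranch_child_subset hG hp (mem_nbrs.1 hv).1 (mem_nbrs.1 hv).2
  have hmem : ∀ v ∈ nbrs G a p, v ∈ closedBranch G a p := fun v hv =>
    hsub v hv (mem_closedBranch_root _ _)
  have hva : ∀ v ∈ nbrs G a p, v ≠ a := fun v hv => (mem_nbrs.1 hv).1.ne'
  -- The time left once `v` is informed. Then `wt s a v + τ v = t - ρ - call v`, so larger values
  -- mean earlier calls, and the bound on non-overlapping start times applies.
  refine ⟨fun v => t - recv v, fun v hv => ⟨par, _, _, (hres v hv).2, fun z hz => ?_⟩, ?_⟩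
  · have := ht z (hsub v hv hz)
    linarith
  · have hf : ∀ v ∈ nbrs G a p, wt s a v + (t - recv v) = t - ρ - call v := by
      intro v hv
      have := h.delivery v (hmem v hv) (hva v hv)
      rw [(hres v hv).1] at this
      linarith
    rw [callTime_congr hρ.le hf]
    refine callTime_le_iff.2 ⟨?_, fun v hv => ?_⟩
    · have := ht a (mem_closedBranch_root _ _)
      rwa [h.source] at this
    · have := card_sub_one_mul_le (N := nbrs G a p) (f := call) hρ
        (fun w hw => by
          have := h.informed w (hmem w hw) (hva w hw)
          rwa [(hres w hw).1, h.source] at this)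
        (fun w hw z hz hne => h.sequential w (hmem w hw) z (hmem z hz) (hva w hw) (hva z hz) hne
          ((hres w hw).1.trans (hres z hz).1.symm)) hv
      simp only [sub_le_sub_iff_left]
      linarith

/-- The given schedules of the branches are glued together: `a` calls its receivers in the order of
their ranks, and each branch runs its own schedule, delayed by the arrival time at its root. -/
lemma mem_broadcastTimes_of_callTime_le (hG : G.IsTree) (hρ : 0 < ρ)
    {a p : V} (hp : p = a ∨ G.Adj a p) {t : ℝ} {τ : V → ℝ}
    (hτ : ∀ v ∈ nbrs G a p, τ v ∈ broadcastTimes ρ s v (closedBranch G v a))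
    (ht : callTime ρ (nbrs G a p) (fun v => wt s a v + τ v) ≤ t) :
    t ∈ broadcastTimes ρ s a (closedBranch G a p) := by
  classical
  have hτ' : ∀ v : V, ∃ (par : V → V) (call recv : V → ℝ), v ∈ nbrs G a p →
      IsSchedule ρ s v (closedBranch G v a) par call recv ∧
        ∀ z ∈ closedBranch G v a, recv z ≤ τ v := by
    intro v
    by_cases hv : v ∈ nbrs G a p
    · obtain ⟨par, call, recv, h⟩ := hτ v hv
      exact ⟨par, call, recv, fun _ => h⟩
    · exact ⟨id, 0, 0, fun h => absurd h hv⟩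
  choose par' call' recv' hsch using hτ'
  have hch : ∀ z : V, ∃ v, z ∈ closedBranch G a p → z ≠ a →
      v ∈ nbrs G a p ∧ z ∈ closedBranch G v a := by
    intro z
    by_cases hz : z ∈ closedBranch G a p ∧ z ≠ a
    · obtain ⟨v, hv, hvp, hzv⟩ := exists_child hG hp hz.1 hz.2
      exact ⟨v, fun _ _ => ⟨mem_nbrs.2 ⟨hv, hvp⟩, hzv⟩⟩
    · exact ⟨z, fun h1 h2 => absurd ⟨h1, h2⟩ hz⟩
  choose ch hch using hch
  obtain ⟨rk, hinj, hrk⟩ := exists_rank (nbrs G a p) fun v => wt s a v + τ v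
  have hsub : ∀ v ∈ nbrs G a p, closedBranch G v a ⊆ closedBranch G a p := fun v hv =>
    closedBranch_child_subset hG hp (mem_nbrs.1 hv).1 (mem_nbrs.1 hv).2
  have hane : ∀ v ∈ nbrs G a p, ∀ z ∈ closedBranch G v a, z ≠ a := by
    rintro v hv z hz rfl
    exact root_notMem_closedBranch hG (mem_nbrs.1 hv).1 hz
  have hch_eq : ∀ v ∈ nbrs G a p, ∀ z ∈ closedBranch G v a, ch z = v := by
    intro v hv z hz
    have h1 := hch z (hsub v hv hz) (hane v hv z hz)
    exact child_unique hG (mem_nbrs.1 h1.1).1 (mem_nbrs.1 hv).1 h1.2 hz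
  -- Arrival time at the receiver `v`, whose connection occupies the `rk v`-th slot and so starts at
  -- `(rk v - 1) * ρ`. Below, `ch z` is the neighbour of `a` whose branch contains `z`, and `z = ch
  -- z` marks the receivers of `a` itself.
  let base : V → ℝ := fun v => rk v * ρ + wt s a v
  let par : V → V := fun z => if z = ch z then a else par' (ch z) z
  let call : V → ℝ := fun z =>
    if z = ch z then ((rk z : ℝ) - 1) * ρ else base (ch z) + call' (ch z) z
  let recv : V → ℝ := fun z => if z = a then 0 else base (ch z) + recv' (ch z) z
  have hpar : ∀ z ∈ closedBranch G a p, z ≠ a → z ≠ ch z →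
      par z = par' (ch z) z ∧ par z ∈ closedBranch G (ch z) a ∧ ch (par z) = ch z := by
    intro z hz hza hzc
    obtain ⟨hv, hzv⟩ := hch z hz hza
    have h1 : par z = par' (ch z) z := if_neg hzc
    have h2 : par z ∈ closedBranch G (ch z) a := by
      rw [h1]
      exact (hsch _ hv).1.par_mem z hzv hzc
    exact ⟨h1, h2, hch_eq _ hv _ h2⟩
  have hrk1 : ∀ v ∈ nbrs G a p, (1 : ℝ) ≤ rk v := fun v hv => by exact_mod_cast (hrk v hv).1
  refine ⟨par, call, recv, ⟨if_pos rfl, ?_, ?_, ?_, ?_, ?_⟩, ?_⟩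
  · intro z hz hza
    by_cases hzc : z = ch z
    · have : par z = a := if_pos hzc
      rw [this]
      exact mem_closedBranch_root _ _
    · exact hsub _ (hch z hz hza).1 (hpar z hz hza hzc).2.1
  · intro z hz hza
    by_cases hzc : z = ch z
    · have : par z = a := if_pos hzc
      rw [this, hzc]
      exact (mem_nbrs.1 (hch z hz hza).1).1
    · rw [(hpar z hz hza hzc).1]
      exact (hsch _ (hch z hz hza).1).1.adj z (hch z hz hza).2 hzc
  · intro z hz hza
    by_cases hzc : z = ch z
    · have h1 : par z = a := if_pos hzc
      have h2 : call z = ((rk z : ℝ) - 1) * ρ := if_pos hzc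
      have h3 : recv a = 0 := if_pos rfl
      have h4 := hrk1 _ (hch z hz hza).1
      rw [← hzc] at h4
      rw [h1, h2, h3]
      exact mul_nonneg (by linarith) hρ.le
    · have h1 := hpar z hz hza hzc
      have h2 : call z = base (ch z) + call' (ch z) z := if_neg hzc
      have h3 : recv (par z) = base (ch (par z)) + recv' (ch (par z)) (par z) :=
        if_neg (hane _ (hch z hz hza).1 _ h1.2.1)
      rw [h2, h3, h1.2.2, h1.1]
      have := (hsch _ (hch z hz hza).1).1.informed z (hch z hz hza).2 hzc
      linarith
  · intro z hz hza
    have h0 : recv z = base (ch z) + recv' (ch z) z := if_neg hza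
    by_cases hzc : z = ch z
    · have h1 : par z = a := if_pos hzc
      have h2 : call z = ((rk z : ℝ) - 1) * ρ := if_pos hzc
      have h3 := (hsch _ (hch z hz hza).1).1.source
      rw [← hzc] at h3 h0
      rw [h0, h1, h2, h3]
      simp only [base]
      ring
    · have h1 := hpar z hz hza hzc
      have h2 : call z = base (ch z) + call' (ch z) z := if_neg hzc
      rw [h0, h1.1, h2, (hsch _ (hch z hz hza).1).1.delivery z (hch z hz hza).2 hzc]
      ring
  · intro z hz z' hz' hza hza' hne hpp
    have hN := hch z hz hza
    have hN' := hch z' hz' hza'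
    by_cases hzc : z = ch z <;> by_cases hzc' : z' = ch z'
    · have h2 : call z = ((rk z : ℝ) - 1) * ρ := if_pos hzc
      have h2' : call z' = ((rk z' : ℝ) - 1) * ρ := if_pos hzc'
      rw [← hzc] at hN
      rw [← hzc'] at hN'
      rw [h2, h2']
      rcases lt_or_gt_of_ne (fun h => hne (hinj hN.1 hN'.1 h)) with h | h
      · left
        have : (rk z : ℝ) + 1 ≤ rk z' := by exact_mod_cast h
        nlinarith
      · right
        have : (rk z' : ℝ) + 1 ≤ rk z := by exact_mod_cast h
        nlinarith
    · have h1 : par z = a := if_pos hzc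
      have h1' := hpar z' hz' hza' hzc'
      rw [← hpp, h1] at h1'
      exact absurd rfl (hane _ hN'.1 _ h1'.2.1)
    · have h1 : par z' = a := if_pos hzc'
      have h1' := hpar z hz hza hzc
      rw [hpp, h1] at h1'
      exact absurd rfl (hane _ hN.1 _ h1'.2.1)
    · have h1 := hpar z hz hza hzc
      have h1' := hpar z' hz' hza' hzc'
      have hcc : ch z' = ch z := by rw [← h1.2.2, ← h1'.2.2, hpp]
      have h2 : call z = base (ch z) + call' (ch z) z := if_neg hzc
      have h2' : call z' = base (ch z') + call' (ch z') z' := if_neg hzc'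
      rw [h1.1, h1'.1, hcc] at hpp
      rw [hcc] at h2' hzc' hN'
      rw [h2, h2']
      rcases (hsch _ hN.1).1.sequential z hN.2 z' hN'.2 hzc hzc' hne hpp with h | h
      · left; linarith
      · right; linarith
  · intro z hz
    have ht' := callTime_le_iff.1 ht
    by_cases hza : z = a
    · have : recv z = 0 := if_pos hza
      rw [this]
      exact ht'.1
    · have h0 : recv z = base (ch z) + recv' (ch z) z := if_neg hza
      obtain ⟨hN, hz'⟩ := hch z hz hza
      have h1 := ht'.2 _ hN
      have h2 := (hsch _ hN).2 z hz'
      have h3 : (rk (ch z) : ℝ) ≤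
        ((nbrs G a p).filter fun w => wt s a (ch z) + τ (ch z) ≤ wt s a w + τ w).card := by
          exact_mod_cast (hrk _ hN).2
      have h4 := mul_le_mul_of_nonneg_right h3 hρ.le
      rw [h0]
      simp only [base]
      linarith

lemma ncard_closedBranch_lt (hG : G.IsTree) {a p v : V} (hp : p = a ∨ G.Adj a p)
    (hv : G.Adj a v) (hvp : v ≠ p) :
    (closedBranch G v a).ncard < (closedBranch G a p).ncard := by
  refine Set.ncard_lt_ncard ⟨closedBranch_child_subset hG hp hv hvp, fun h => ?_⟩
    (Set.toFinite _)
  exact root_notMem_closedBranch hG hv (h (mem_closedBranch_root _ _))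

/-- Induction along the branches of a tree, from the leaves. -/
lemma branch_induction (hG : G.IsTree) {P : V → V → Prop}
    (step : ∀ a p, (p = a ∨ G.Adj a p) → (∀ v ∈ nbrs G a p, P v a) → P a p) :
    ∀ a p, (p = a ∨ G.Adj a p) → P a p := by
  intro a p hp
  induction hn : (closedBranch G a p).ncard using Nat.strong_induction_on generalizing a p with
  | _ n ih =>
    refine step a p hp fun v hv => ?_
    rw [mem_nbrs] at hv
    exact ih _ (hn ▸ ncard_closedBranch_lt hG hp hv.1 hv.2) v a (Or.inr hv.1.symm) rfl

/-- A closed ray, and not merely its infimum, is carried through the induction: gluing needs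
schedules of the branches that attain their broadcast times. -/
lemma broadcastTimes_eq_Ici (hG : G.IsTree) (hρ : 0 < ρ) (hs : ∀ e, 0 ≤ s e) :
    ∀ a p, (p = a ∨ G.Adj a p) → broadcastTimes ρ s a (closedBranch G a p) =
      Set.Ici (callTime ρ (nbrs G a p) (branchValue ρ s a)) := by
  refine branch_induction hG fun a p hp ih => ?_
  have hb : ∀ v ∈ nbrs G a p, broadcastTimes ρ s v (closedBranch G v a) =
      Set.Ici (bTime ρ s v (closedBranch G v a)) := by
    intro v hv
    have h := ih v hv
    have : bTime ρ s v (closedBranch G v a) = sInf (broadcastTimes ρ s v (closedBranch G v a)) :=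
      rfl
    rw [this, h, csInf_Ici]
  ext t
  constructor
  · intro ht
    obtain ⟨τ, hτ, hle⟩ := exists_of_mem_broadcastTimes hG hρ hs hp ht
    refine le_trans (callTime_mono hρ.le subset_rfl fun v hv => ?_) hle
    have := hτ v hv
    rw [hb v hv, Set.mem_Ici] at this
    exact add_le_add_right this _
  · intro ht
    refine mem_broadcastTimes_of_callTime_le hG hρ hp
      (τ := fun v => bTime ρ s v (closedBranch G v a)) (fun v hv => ?_) ht
    rw [hb v hv]
    exact Set.self_mem_Ici

/-- The recursion for the broadcast time over a branch. -/
lemma bTime_closedBranch (hG : G.IsTree) (hρ : 0 < ρ) (hs : ∀ e, 0 ≤ s e) {a p : V}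
    (hp : p = a ∨ G.Adj a p) :
    bTime ρ s a (closedBranch G a p) = callTime ρ (nbrs G a p) (branchValue ρ s a) := by
  have : bTime ρ s a (closedBranch G a p) = sInf (broadcastTimes ρ s a (closedBranch G a p)) := rfl
  rw [this, broadcastTimes_eq_Ici hG hρ hs a p hp, csInf_Ici]

lemma bTime_univ (hG : G.IsTree) (hρ : 0 < ρ) (hs : ∀ e, 0 ≤ s e) (a : V) :
    bTime ρ s a Set.univ = callTime ρ (nbrs G a a) (branchValue ρ s a) := by
  rw [← closedBranch_self (G := G) a, bTime_closedBranch hG hρ hs (Or.inl rfl)]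

end Recursion

end Broadcast

namespace Broadcast

/-! ### Dependence of broadcast times on the weights -/

section Perturbation

variable {V : Type*} {G : SimpleGraph V} {ρ : ℝ} {s s' : Weights G}

lemma bTime_le_branchValue (hs : ∀ e, 0 ≤ s e) (a v : V) :
    bTime ρ s v (closedBranch G v a) ≤ branchValue ρ s a v :=
  le_add_of_nonneg_left (wt_nonneg hs a v)

variable [Fintype V]

open Classical in
-- The value of each child rises by at most the increases on its edge and inside its branch, and
-- `callTime` rises by at most a common bound on these. This one-sided estimate gives monotonicity,
-- continuity and the bound in the first transformation.
lemma bTime_le_add_sum [Fintype G.edgeSet] (hG : G.IsTree) (hρ : 0 < ρ) (hs : ∀ e, 0 ≤ s e)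
    (hs' : ∀ e, 0 ≤ s' e) : ∀ a p, (p = a ∨ G.Adj a p) →
    bTime ρ s' a (closedBranch G a p) ≤ bTime ρ s a (closedBranch G a p) +
      ∑ e ∈ Finset.univ.filter (· ∈ edgesIn G (closedBranch G a p)), max (s' e - s e) 0 := by
  refine branch_induction hG fun a p hp ih => ?_
  rw [bTime_closedBranch hG hρ hs hp, bTime_closedBranch hG hρ hs' hp]
  refine callTime_le_add hρ.le (Finset.sum_nonneg fun _ _ => le_max_right _ _) fun v hv => ?_
  have h1 := ih v hv
  rw [mem_nbrs] at hv
  have hsub := branchEdges_subset_edgesIn hG hp hv.1 hv.2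
  have h2 : ∑ e ∈ insert ⟨s(a, v), hv.1⟩
      (Finset.univ.filter (· ∈ edgesIn G (closedBranch G v a))), max (s' e - s e) 0 ≤
      ∑ e ∈ Finset.univ.filter (· ∈ edgesIn G (closedBranch G a p)), max (s' e - s e) 0 := by
    refine Finset.sum_le_sum_of_subset_of_nonneg ?_ fun _ _ _ => le_max_right _ _
    intro e he
    rw [Finset.mem_insert, Finset.mem_filter] at he
    refine Finset.mem_filter.2 ⟨Finset.mem_univ _, hsub ?_⟩
    rcases he with rfl | he
    · exact Or.inl rfl
    · exact Or.inr he.2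
  rw [Finset.sum_insert] at h2
  · have h3 := le_max_left (s' ⟨s(a, v), hv.1⟩ - s ⟨s(a, v), hv.1⟩) 0
    simp only [branchValue, wt_of_adj hv.1]
    linarith
  · exact fun h => root_notMem_closedBranch hG hv.1 ((Finset.mem_filter.1 h).2 a (by simp))

lemma bTime_mono (hG : G.IsTree) (hρ : 0 < ρ) (hs : ∀ e, 0 ≤ s e)
    (hs' : ∀ e, 0 ≤ s' e) {a p : V} (hp : p = a ∨ G.Adj a p)
    (h : ∀ e ∈ edgesIn G (closedBranch G a p), s' e ≤ s e) :
    bTime ρ s' a (closedBranch G a p) ≤ bTime ρ s a (closedBranch G a p) := by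
  classical
  have := Fintype.ofFinite G.edgeSet
  have h1 := bTime_le_add_sum hG hρ hs hs' a p hp
  rwa [Finset.sum_eq_zero, add_zero] at h1
  intro e he
  exact max_eq_right (sub_nonpos.2 (h e (Finset.mem_filter.1 he).2))

lemma branchValue_mono (hG : G.IsTree) (hρ : 0 < ρ) (hs : ∀ e, 0 ≤ s e)
    (hs' : ∀ e, 0 ≤ s' e) {a v : V} (hv : G.Adj a v)
    (h : ∀ e ∈ branchEdges G a v, s' e ≤ s e) : branchValue ρ s' a v ≤ branchValue ρ s a v := by
  have h1 := bTime_mono hG hρ hs hs' (Or.inr hv.symm) fun e he => h e (Or.inr he)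
  have h2 := h ⟨s(a, v), hv⟩ (Or.inl rfl)
  simp only [branchValue, wt_of_adj hv]
  linarith

lemma branchValue_congr (hG : G.IsTree) (hρ : 0 < ρ) (hs : ∀ e, 0 ≤ s e)
    (hs' : ∀ e, 0 ≤ s' e) {a v : V} (hv : G.Adj a v)
    (h : ∀ e ∈ branchEdges G a v, s' e = s e) : branchValue ρ s' a v = branchValue ρ s a v :=
  le_antisymm (branchValue_mono hG hρ hs hs' hv fun e he => (h e he).le)
    (branchValue_mono hG hρ hs' hs hv fun e he => (h e he).ge)

lemma bTime_nonneg (hG : G.IsTree) (hρ : 0 < ρ) (hs : ∀ e, 0 ≤ s e) {a p : V}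
    (hp : p = a ∨ G.Adj a p) : 0 ≤ bTime ρ s a (closedBranch G a p) := by
  rw [bTime_closedBranch hG hρ hs hp]
  exact callTime_nonneg

lemma branchValue_nonneg (hG : G.IsTree) (hρ : 0 < ρ) (hs : ∀ e, 0 ≤ s e) {a v : V}
    (hv : G.Adj a v) : 0 ≤ branchValue ρ s a v :=
  add_nonneg (wt_nonneg hs a v) (bTime_nonneg hG hρ hs (Or.inr hv.symm))

end Perturbation

/-! ### Path costs, and the criterion as a lower bound for the regret -/

section Paths

variable {V : Type*} {G : SimpleGraph V} {ρ : ℝ} {s : Weights G}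

/-- The cost `d_{x,y} ρ + w̃^s_{x,y}` of the path from `x` to `y`. -/
noncomputable def pathCost (ρ : ℝ) (s : Weights G) (x y : V) : ℝ :=
  (pathEdges G x y).ncard * ρ + pathWeight s x y

lemma criterion_eq (x y : V) : criterion ρ s x y =
    pathCost ρ s x y + bTime ρ s y (closedBranch G y x) - bTime ρ s y Set.univ := rfl

lemma pathCost_self (hG : G.IsTree) (x : V) : pathCost ρ s x x = 0 := by
  simp [pathCost, pathWeight, pathEdges_self hG]

lemma pathCost_nonneg (hρ : 0 < ρ) (hs : ∀ e, 0 ≤ s e) (x y : V) : 0 ≤ pathCost ρ s x y :=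
  add_nonneg (by positivity) (finsum_nonneg fun e => finsum_nonneg fun _ => hs e)

/-- `p` is the neighbour of `a` toward `x`, or `a` itself when `x = a`. -/
lemma exists_toward (hG : G.IsTree) (x a : V) : ∃ p, (p = a ∨ G.Adj a p) ∧
    closedBranch G a x = closedBranch G a p ∧ (a ≠ x → G.Adj a p ∧ p ∈ openBranch G a x) ∧
    ∀ v, G.Adj a v → (v = p ↔ v ∈ openBranch G a x) := by
  by_cases h : a = x
  · subst h
    refine ⟨a, Or.inl rfl, rfl, fun h => absurd rfl h, fun v hv => iff_of_false hv.ne' ?_⟩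
    rintro ⟨p, hp⟩
    exact hp p.start_mem_support
  · obtain ⟨p, hp, hd⟩ := exists_parent hG h
    have hpo := (mem_openBranch_adj_iff hG hp).2 hd
    refine ⟨p, Or.inr hp, closedBranch_eq_of_mem hpo, fun _ => ⟨hp, hpo⟩, fun v hv => ?_⟩
    constructor
    · rintro rfl
      exact hpo
    · intro hvo
      exact parent_unique hG hv hp ((mem_openBranch_adj_iff hG hv).1 hvo) hd

variable [Fintype V]

lemma pathCost_step (hG : G.IsTree) {x y v : V} (hv : G.Adj y v) (hvo : v ∈ openBranch G y x) :
    pathCost ρ s x y = pathCost ρ s x v + ρ + wt s v y := by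
  have hnot := edge_notMem_pathEdges hG hv hvo
  rw [pathCost, pathWeight, pathEdges_eq_insert hG hv hvo,
    Set.ncard_insert_of_notMem hnot (Set.toFinite _), finsum_mem_insert _ hnot (Set.toFinite _),
    wt_comm, wt_of_adj hv, pathCost, pathWeight]
  push_cast
  ring

/-- The induction step along a path leaving `x`. -/
lemma mem_nbrs_of_toward (hG : G.IsTree) {x y v p : V} (hv : G.Adj y v)
    (hvo : v ∈ openBranch G y x) (hp : ∀ w, G.Adj v w → (w = p ↔ w ∈ openBranch G v x)) :
    y ∈ nbrs G v p := by
  rw [mem_nbrs]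
  refine ⟨hv.symm, fun h => ?_⟩
  have h1 := (mem_openBranch_adj_iff hG hv.symm).1 ((hp y hv.symm).1 h)
  have h2 := (mem_openBranch_adj_iff hG hv).1 hvo
  omega

/-- Induction along the path: the vertex before `y` has to connect to `y`, wait for delivery, and
let `y` cover its branch. -/
lemma pathCost_add_bTime_le (hG : G.IsTree) (hρ : 0 < ρ) (hs : ∀ e, 0 ≤ s e) (x y : V) :
    pathCost ρ s x y + bTime ρ s y (closedBranch G y x) ≤ bTime ρ s x Set.univ := by
  induction hn : G.dist x y generalizing y with
  | zero =>
    have : x = y := hG.connected.dist_eq_zero_iff.1 hn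
    subst this
    rw [pathCost_self hG, closedBranch_self, zero_add]
  | succ n ih =>
    have hne : y ≠ x := by
      rintro rfl
      simp at hn
    obtain ⟨v, hv, hd⟩ := exists_parent hG hne
    have hvo := (mem_openBranch_adj_iff hG hv).2 hd
    have h1 := ih v (by omega)
    obtain ⟨p, hp, hpc, -, hpu⟩ := exists_toward hG x v
    rw [hpc, bTime_closedBranch hG hρ hs hp] at h1
    have h2 := add_le_callTime (f := branchValue ρ s v) hρ.le (mem_nbrs_of_toward hG hv hvo hpu)
    rw [pathCost_step hG hv hvo, closedBranch_eq_of_mem hvo]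
    rw [branchValue] at h2
    linarith

/-- The heavier side of an edge determines the broadcast time from the other side. -/
lemma bTime_univ_eq_of_le (hG : G.IsTree) (hρ : 0 < ρ) (hs : ∀ e, 0 ≤ s e) (x y v : V)
    (hv : G.Adj y v) (hvo : v ∈ openBranch G y x)
    (h : bTime ρ s v (closedBranch G v y) ≤ bTime ρ s y (closedBranch G y v)) :
    bTime ρ s x Set.univ = pathCost ρ s x y + bTime ρ s y (closedBranch G y x) := by
  classical
  induction hn : G.dist x y generalizing y v with
  | zero =>
    have := (mem_openBranch_adj_iff hG hv).1 hvo
    omega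
  | succ n ih =>
    have hd := (mem_openBranch_adj_iff hG hv).1 hvo
    obtain ⟨p, hp, hpc, hpx, hpu⟩ := exists_toward hG x v
    have hyp := mem_nbrs_of_toward hG hv hvo hpu
    have hvy := bTime_closedBranch hG hρ hs (a := v) (p := y) (Or.inr hv.symm)
    have hF := bTime_le_branchValue (ρ := ρ) hs v y
    -- It is optimal for `v` to serve `y` first: its other receivers need at most `bTime ρ s v
    -- (closedBranch G v y)`, which by `h` is at most the value of `y`.
    have h1 : bTime ρ s v (closedBranch G v x) = ρ + branchValue ρ s v y := by
      rw [hpc, bTime_closedBranch hG hρ hs hp]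
      refine le_antisymm ?_ (add_le_callTime hρ.le hyp)
      rw [← Finset.insert_erase hyp]
      refine (callTime_insert_le hρ.le).trans ?_
      have h2 : callTime ρ ((nbrs G v p).erase y) (branchValue ρ s v) ≤
          callTime ρ (nbrs G v y) (branchValue ρ s v) := by
        refine callTime_mono hρ.le (fun w hw => ?_) fun _ _ => le_rfl
        rw [Finset.mem_erase, mem_nbrs] at hw
        exact mem_nbrs.2 ⟨hw.2.1, hw.1⟩
      rw [max_eq_left (by linarith)]
    have h3 : bTime ρ s x Set.univ = pathCost ρ s x v + bTime ρ s v (closedBranch G v x) := by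
      by_cases hvx : v = x
      · subst hvx
        rw [pathCost_self hG, closedBranch_self, zero_add]
      · obtain ⟨hvp, hpo⟩ := hpx hvx
        -- The imbalance persists on the next edge toward `x`: the side of `p` is part of what `v`
        -- covers away from `y`, and the side of `y` is part of what `v` covers away from `p`.
        refine ih v p hvp hpo ?_ (by omega)
        have h4 : ρ + branchValue ρ s v p ≤ callTime ρ (nbrs G v y) (branchValue ρ s v) :=
          add_le_callTime hρ.le (mem_nbrs.2 ⟨hvp, (mem_nbrs.1 hyp).2.symm⟩)
        have h5 := bTime_le_branchValue (ρ := ρ) hs v p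
        have h6 := add_le_callTime (f := branchValue ρ s v) hρ.le hyp
        rw [bTime_closedBranch hG hρ hs hp]
        linarith
    rw [h3, h1, pathCost_step hG hv hvo, closedBranch_eq_of_mem hvo, branchValue]
    ring

lemma criterion_le_regret (hG : G.IsTree) (hρ : 0 < ρ) (hs : ∀ e, 0 ≤ s e) (x y : V) :
    criterion ρ s x y ≤ regret ρ s x y := by
  have := pathCost_add_bTime_le hG hρ hs x y
  rw [criterion_eq, regret]
  linarith

lemma criterion_eq_regret (hG : G.IsTree) (hρ : 0 < ρ) (hs : ∀ e, 0 ≤ s e) {x y : V}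
    (hxy : y ≠ x) (hy : IsPrimeCenter ρ s y) : criterion ρ s x y = regret ρ s x y := by
  obtain ⟨v, hv, hd⟩ := exists_parent hG hxy
  have := bTime_univ_eq_of_le hG hρ hs x y v hv ((mem_openBranch_adj_iff hG hv).2 hd) (hy.2 v hv)
  rw [criterion_eq, regret]
  linarith

end Paths

/-! ### Existence and location of prime centers -/

section Centers

variable {V : Type*} {G : SimpleGraph V} {ρ : ℝ} {s : Weights G} [Fintype V]

lemma nbrs_self_eq_insert [DecidableEq V] {a m : V} (hm : G.Adj a m) :
    nbrs G a a = insert m (nbrs G a m) := by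
  ext v
  simp only [mem_nbrs, Finset.mem_insert]
  constructor
  · rintro ⟨h, -⟩
    by_cases hvm : v = m
    · exact Or.inl hvm
    · exact Or.inr ⟨h, hvm⟩
  · rintro (rfl | h)
    · exact ⟨hm, hm.ne'⟩
    · exact ⟨h.1, h.1.ne'⟩

lemma bTime_univ_le (hG : G.IsTree) (hρ : 0 < ρ) (hs : ∀ e, 0 ≤ s e) {a m : V}
    (hm : G.Adj a m) : bTime ρ s a Set.univ ≤
      ρ + max (branchValue ρ s a m) (bTime ρ s a (closedBranch G a m)) := by
  classical
  rw [bTime_univ hG hρ hs, nbrs_self_eq_insert hm, bTime_closedBranch hG hρ hs (Or.inr hm)]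
  exact callTime_insert_le hρ.le

/-- The time from `z` is exactly the path cost up to `m`, plus `ρ`, the weight of `(m, k)` and the
time of `k` away from `m`. Starting at `k` and calling `m` first takes no longer than the last three
terms. -/
lemma pathCost_add_bTime_le_of_balanced (hG : G.IsTree) (hρ : 0 < ρ) (hs : ∀ e, 0 ≤ s e)
    {k z m : V} (hm : G.Adj k m) (hmo : m ∈ openBranch G k z)
    (hk : bTime ρ s m (closedBranch G m k) ≤ bTime ρ s k (closedBranch G k m)) :
    pathCost ρ s z m + bTime ρ s k Set.univ ≤ bTime ρ s z Set.univ := by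
  have h1 := bTime_univ_eq_of_le hG hρ hs z k m hm hmo hk
  have h2 := bTime_univ_le hG hρ hs hm
  rw [pathCost_step hG hm hmo, closedBranch_eq_of_mem hmo] at h1
  have h3 : max (branchValue ρ s k m) (bTime ρ s k (closedBranch G k m)) ≤
      wt s m k + bTime ρ s k (closedBranch G k m) := by
    rw [branchValue, wt_comm k m]
    exact max_le (by linarith) (by linarith [wt_nonneg hs m k])
  linarith

lemma isPrimeCenter_of_balanced (hG : G.IsTree) (hρ : 0 < ρ) (hs : ∀ e, 0 ≤ s e) {k : V}
    (hk : ∀ u, G.Adj k u →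
      bTime ρ s u (closedBranch G u k) ≤ bTime ρ s k (closedBranch G k u)) :
    IsPrimeCenter ρ s k := by
  refine ⟨fun z => ?_, hk⟩
  by_cases hzk : k = z
  · rw [hzk]
  · obtain ⟨m, hm, hd⟩ := exists_parent hG hzk
    have := pathCost_add_bTime_le_of_balanced hG hρ hs hm ((mem_openBranch_adj_iff hG hm).2 hd)
      (hk m hm)
    linarith [pathCost_nonneg (s := s) hρ hs z m]

/-- If no vertex is balanced, each points to a neighbour with a strictly heavier side. By induction
from the leaves it never points away from `p`, so no side is heavier than the opposite one, which is
absurd. -/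
lemma exists_isPrimeCenter (hG : G.IsTree) (hρ : 0 < ρ) (hs : ∀ e, 0 ≤ s e) :
    ∃ k, IsPrimeCenter ρ s k := by
  by_contra! hne
  have hbad : ∀ k, ∃ u, G.Adj k u ∧
      bTime ρ s k (closedBranch G k u) < bTime ρ s u (closedBranch G u k) := by
    intro k
    by_contra! h
    exact hne k (isPrimeCenter_of_balanced hG hρ hs h)
  have key : ∀ a p, (p = a ∨ G.Adj a p) →
      bTime ρ s a (closedBranch G a p) ≤ bTime ρ s p (closedBranch G p a) := by
    refine branch_induction hG fun a p hp ih => ?_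
    obtain ⟨u, hu, hlt⟩ := hbad a
    by_contra! h
    refine (ih u (mem_nbrs.2 ⟨hu, ?_⟩)).not_gt hlt
    rintro rfl
    exact lt_asymm h hlt
  obtain ⟨k⟩ := hG.connected.nonempty
  obtain ⟨u, hu, hlt⟩ := hbad k
  exact (key u k (Or.inr hu.symm)).not_gt hlt

/-- A center is equal or adjacent to each prime center. -/
lemma IsCenter.eq_or_adj (hG : G.IsTree) (hρ : 0 < ρ) (hs : ∀ e, 0 ≤ s e) {y k : V}
    (hy : IsCenter ρ s y) (hk : IsPrimeCenter ρ s k) : k = y ∨ G.Adj k y := by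
  by_contra! hne
  obtain ⟨m, hm, hd⟩ := exists_parent hG hne.1
  have h1 := pathCost_add_bTime_le_of_balanced hG hρ hs hm ((mem_openBranch_adj_iff hG hm).2 hd)
    (hk.2 m hm)
  have h2 := hy k
  have hmy : m ≠ y := by
    rintro rfl
    exact hne.2 hm
  -- At distance at least two, the path from `y` to `m` has an edge and costs at least `ρ > 0`. So
  -- `k` would be strictly better than the center `y`.
  obtain ⟨t, ht, hdt⟩ := exists_parent hG hmy
  have h3 := pathCost_step (ρ := ρ) (s := s) hG ht ((mem_openBranch_adj_iff hG ht).2 hdt)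
  have h4 := pathCost_nonneg hρ hs y t
  have h5 := wt_nonneg hs t m
  linarith

end Centers

/-! ### Worst-case scenarios -/

section WorstCase

variable {V : Type*} {G : SimpleGraph V} {ρ : ℝ} {s s' lo hi : Weights G}

lemma nonneg_of_mem_scenarios (hlo : ∀ e, 0 ≤ lo e) (hs : s ∈ scenarios lo hi) (e : G.edgeSet) :
    0 ≤ s e := (hlo e).trans (hs e).1

/-- The regrets of `x`. -/
def regrets (ρ : ℝ) (lo hi : Weights G) (x : V) : Set ℝ :=
  {r | ∃ s' ∈ scenarios lo hi, ∃ y', r = regret ρ s' x y'}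

lemma isWorstCase_of_le {x y : V} {R : ℝ} (hR : IsGreatest (regrets ρ lo hi x) R)
    (hs : s ∈ scenarios lo hi) (h : R ≤ regret ρ s x y) : IsWorstCase ρ lo hi x s := by
  have hmem : regret ρ s x y ∈ regrets ρ lo hi x := ⟨s, hs, y, rfl⟩
  exact ⟨hs, y, hmem, fun r hr => (hR.2 hr).trans h⟩

lemma IsWorstCase.isGreatest {x y : V} (hs : IsWorstCase ρ lo hi x s) (hy : IsCenter ρ s y) :
    IsGreatest (regrets ρ lo hi x) (regret ρ s x y) := by
  obtain ⟨hmem, z, hz⟩ := hs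
  refine ⟨⟨s, hmem, y, rfl⟩, fun r hr => (hz.2 hr).trans ?_⟩
  have := hy z
  rw [regret, regret]
  linarith

/-- The maximum regret is then `regret ρ s x x = 0`, and every scenario attains `0` with `y = x`. -/
lemma isWorstCase_of_isCenter {x : V} (hs : IsWorstCase ρ lo hi x s) (hx : IsCenter ρ s x)
    (hs' : s' ∈ scenarios lo hi) : IsWorstCase ρ lo hi x s' := by
  refine isWorstCase_of_le (hs.isGreatest hx) hs' (y := x) ?_
  simp [regret]

variable [Fintype V]

lemma continuousOn_bTime (hG : G.IsTree) (hρ : 0 < ρ) (hlo : ∀ e, 0 ≤ lo e) (a : V) :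
    ContinuousOn (fun s : Weights G => bTime ρ s a Set.univ) (scenarios lo hi) := by
  classical
  have := Fintype.ofFinite G.edgeSet
  intro s hs
  have hs0 := nonneg_of_mem_scenarios hlo hs
  have hb : ∀ s₁ s₂ : Weights G, (∀ e, 0 ≤ s₁ e) → (∀ e, 0 ≤ s₂ e) →
      bTime ρ s₂ a Set.univ ≤ bTime ρ s₁ a Set.univ + ∑ e, |s₂ e - s₁ e| := by
    intro s₁ s₂ h₁ h₂
    have h := bTime_le_add_sum hG hρ h₁ h₂ a a (Or.inl rfl)
    rw [closedBranch_self] at h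
    refine h.trans (add_le_add_right ?_ _)
    refine (Finset.sum_le_sum fun e _ => max_le (le_abs_self _) (abs_nonneg _)).trans ?_
    exact Finset.sum_le_sum_of_subset_of_nonneg (Finset.subset_univ _) fun _ _ _ => abs_nonneg _
  have hD : Filter.Tendsto (fun s' : Weights G => ∑ e, |s' e - s e|)
      (nhdsWithin s (scenarios lo hi)) (nhds 0) := by
    have hc : Continuous fun s' : Weights G => ∑ e, |s' e - s e| := by fun_prop
    have := hc.tendsto s
    simp only [sub_self, abs_zero, Finset.sum_const_zero] at this
    exact this.mono_left nhdsWithin_le_nhds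
  refine tendsto_of_tendsto_of_tendsto_of_le_of_le'
    (g := fun s' => bTime ρ s a Set.univ - ∑ e, |s' e - s e|)
    (h := fun s' => bTime ρ s a Set.univ + ∑ e, |s' e - s e|) ?_ ?_ ?_ ?_
  · simpa using hD.const_sub (bTime ρ s a Set.univ)
  · simpa using hD.const_add (bTime ρ s a Set.univ)
  · filter_upwards [self_mem_nhdsWithin] with s' hs'
    have := hb s' s (nonneg_of_mem_scenarios hlo hs') hs0
    simp only [abs_sub_comm (s _)] at this
    linarith
  · filter_upwards [self_mem_nhdsWithin] with s' hs'
    exact hb s s' hs0 (nonneg_of_mem_scenarios hlo hs')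

/-- For each of the finitely many `y` the regret is continuous on a compact box. -/
lemma exists_isWorstCase (hG : G.IsTree) (hρ : 0 < ρ) (hlo : ∀ e, 0 ≤ lo e)
    (hlohi : ∀ e, lo e ≤ hi e) (x : V) : ∃ s, IsWorstCase ρ lo hi x s := by
  have hc : IsCompact (scenarios lo hi) := by
    have h := isCompact_univ_pi fun e => isCompact_Icc (a := lo e) (b := hi e)
    convert h using 1
    ext s
    simp only [scenarios, Set.mem_ofPred_eq, Set.mem_pi, Set.mem_univ, true_implies]
  have hne : (scenarios lo hi).Nonempty := ⟨lo, fun e => ⟨le_rfl, hlohi e⟩⟩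
  have hmax : ∀ y, ∃ s ∈ scenarios lo hi, IsMaxOn (fun s => regret ρ s x y) (scenarios lo hi) s :=
    fun y => hc.exists_isMaxOn hne
      ((continuousOn_bTime hG hρ hlo x).sub (continuousOn_bTime hG hρ hlo y))
  choose σ hσ hσm using hmax
  have : Nonempty V := ⟨x⟩
  obtain ⟨y, hy⟩ := Finite.exists_max fun y => regret ρ (σ y) x y
  refine ⟨σ y, hσ y, y, ⟨σ y, hσ y, y, rfl⟩, ?_⟩
  rintro r ⟨s, hs, z, rfl⟩
  exact (hσm z hs).trans (hy z)

end WorstCase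

end Broadcast

namespace Broadcast

/-! ### Sorted arrangements and the shifted sequences -/

section Arrangement

variable {V : Type*} {ρ : ℝ} {N : Finset V} {f : V → ℝ} {h : ℕ} {q u Q₀ : ℕ → V}

lemma card_eq_of_bijOn (hq : Set.BijOn q (Set.Icc 1 h) N) : N.card = h := by
  classical
  have : (Finset.Icc 1 h).image q = N := by
    ext v
    rw [← Finset.mem_coe, ← Finset.mem_coe, ← hq.image_eq]
    simp
  rw [← this, Finset.card_image_of_injOn (by rw [Finset.coe_Icc]; exact hq.injOn)]
  simp

lemma exists_prefix (hq : Set.BijOn q (Set.Icc 1 h) N) {k : ℕ} (hk : k ∈ Set.Icc 1 h) {θ : ℝ}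
    (hθ : ∀ i ∈ Set.Icc 1 k, θ ≤ f (q i)) :
    ∃ A ⊆ N, A.Nonempty ∧ A.card = k ∧ ∀ w ∈ A, θ ≤ f w := by
  classical
  have hsub : Set.Icc 1 k ⊆ Set.Icc 1 h := Set.Icc_subset_Icc_right hk.2
  refine ⟨(Finset.Icc 1 k).image q, ?_, ?_, ?_, ?_⟩
  · intro v hv
    obtain ⟨i, hi, rfl⟩ := Finset.mem_image.1 hv
    exact hq.mapsTo (hsub (by simpa using hi))
  · exact ⟨q k, Finset.mem_image_of_mem _ (Finset.mem_Icc.2 ⟨hk.1, le_rfl⟩)⟩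
  · rw [Finset.card_image_of_injOn (by rw [Finset.coe_Icc]; exact hq.injOn.mono hsub)]
    simp
  · intro v hv
    obtain ⟨i, hi, rfl⟩ := Finset.mem_image.1 hv
    exact hθ i (by simpa using hi)

lemma mul_add_le_callTime_of_prefix (hρ : 0 ≤ ρ) (hq : Set.BijOn q (Set.Icc 1 h) N) {k : ℕ}
    (hk : k ∈ Set.Icc 1 h) {θ : ℝ} (hθ : ∀ i ∈ Set.Icc 1 k, θ ≤ f (q i)) :
    (k : ℝ) * ρ + θ ≤ callTime ρ N f := by
  obtain ⟨A, hA, hne, hcard, hθA⟩ := exists_prefix hq hk hθ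
  rw [← hcard]
  exact card_mul_add_le_callTime hρ hA hne hθA

lemma mul_add_le_callTime (hρ : 0 ≤ ρ) (hq : Set.BijOn q (Set.Icc 1 h) N)
    (hanti : AntitoneOn (fun k => f (q k)) (Set.Icc 1 h)) {k : ℕ} (hk : k ∈ Set.Icc 1 h) :
    (k : ℝ) * ρ + f (q k) ≤ callTime ρ N f :=
  mul_add_le_callTime_of_prefix hρ hq hk fun _ hi =>
    hanti ⟨hi.1, hi.2.trans hk.2⟩ hk hi.2

/-- If entry number `A.card` were below `θ`, then all of `A` would fit into the first `A.card - 1`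
positions. -/
lemma le_apply_card (hq : Set.BijOn q (Set.Icc 1 h) N)
    (hanti : AntitoneOn (fun k => f (q k)) (Set.Icc 1 h)) {A : Finset V} (hA : A ⊆ N)
    (hne : A.Nonempty) {θ : ℝ} (hθ : ∀ w ∈ A, θ ≤ f w) : θ ≤ f (q A.card) := by
  classical
  by_contra! hlt
  have h1 : 1 ≤ A.card := Finset.card_pos.2 hne
  have h2 : A.card ≤ h := card_eq_of_bijOn hq ▸ Finset.card_le_card hA
  have hsub : A ⊆ (Finset.Icc 1 (A.card - 1)).image q := by
    intro w hw
    obtain ⟨i, hi, rfl⟩ := hq.surjOn (hA hw)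
    refine Finset.mem_image_of_mem _ (Finset.mem_Icc.2 ⟨hi.1, ?_⟩)
    by_contra! hc
    have h3 : f (q i) ≤ f (q A.card) := hanti ⟨h1, h2⟩ hi (by omega)
    linarith [hθ _ hw]
  have := (Finset.card_le_card hsub).trans Finset.card_image_le
  simp only [Nat.card_Icc] at this
  omega

lemma exists_callTime_eq_position (hρ : 0 ≤ ρ) (hq : Set.BijOn q (Set.Icc 1 h) N)
    (hanti : AntitoneOn (fun k => f (q k)) (Set.Icc 1 h)) (hh : 1 ≤ h)
    (hf : ∀ v ∈ N, 0 ≤ f v) : ∃ k ∈ Set.Icc 1 h, callTime ρ N f = k * ρ + f (q k) := by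
  obtain ⟨v, hv, he⟩ := exists_callTime_eq ⟨q 1, hq.mapsTo ⟨le_rfl, hh⟩⟩ hρ hf
  have hne : (N.filter fun w => f v ≤ f w).Nonempty := ⟨v, by simp [hv]⟩
  have hk : (N.filter fun w => f v ≤ f w).card ∈ Set.Icc 1 h :=
    ⟨Finset.card_pos.2 hne, card_eq_of_bijOn hq ▸ Finset.card_le_card (Finset.filter_subset _ _)⟩
  refine ⟨_, hk, le_antisymm ?_ (mul_add_le_callTime hρ hq hanti hk)⟩
  rw [he]
  gcongr
  exact le_apply_card hq hanti (Finset.filter_subset _ _) hne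
    fun w hw => (Finset.mem_filter.1 hw).2

lemma exists_isLeast_nat {S : Set ℕ} (hS : S.Nonempty) : ∃ k, IsLeast S k :=
  ⟨sInf S, Nat.sInf_mem hS, fun _ h => Nat.sInf_le h⟩

/-- The invariant of the shifting: a prefix `u 1, ..., u j`, followed by the remaining entries in
their original relative order. -/
lemma shiftSeq_spec {N : Set V} (hu : Set.BijOn u (Set.Icc 1 h) N)
    (hQ : Set.BijOn Q₀ (Set.Icc 1 h) N)
    (hanti : AntitoneOn (fun k => f (Q₀ k)) (Set.Icc 1 h)) (j : ℕ) (hj : j ≤ h) :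
    (∀ k, 1 ≤ k → k ≤ j → shiftSeq h u Q₀ j k = u k) ∧
      Set.BijOn (shiftSeq h u Q₀ j) (Set.Icc 1 h) N ∧
      AntitoneOn (fun k => f (shiftSeq h u Q₀ j k)) (Set.Ioc j h) := by
  induction j with
  | zero =>
    refine ⟨fun k h1 h2 => by omega, hQ, hanti.mono ?_⟩
    intro k hk
    exact ⟨hk.1, hk.2⟩
  | succ j ih =>
    obtain ⟨ih1, ih2, ih3⟩ := ih (by omega)
    obtain ⟨l, hl, hlu⟩ := ih2.surjOn (hu.mapsTo (show j + 1 ∈ Set.Icc 1 h from ⟨by omega, hj⟩))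
    have hjl : j < l := by
      by_contra! hc
      rw [ih1 l hl.1 hc] at hlu
      have := hu.injOn hl ⟨by omega, hj⟩ hlu
      omega
    -- One shift as a permutation of positions: entry `k` of the new sequence is entry `σ k` of the
    -- old one, where `l > j` is the old position of `u (j + 1)`.
    let σ : ℕ → ℕ := fun k =>
      if k ≤ j then k else if k = j + 1 then l else if k ≤ l then k - 1 else k
    have hσ : ∀ k ∈ Set.Icc 1 h, shiftSeq h u Q₀ (j + 1) k = shiftSeq h u Q₀ j (σ k) := by
      intro k hk
      have hiff : (∃ l, k ≤ l ∧ l ≤ h ∧ shiftSeq h u Q₀ j l = u (j + 1)) ↔ k ≤ l := by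
        constructor
        · rintro ⟨i, hki, hih, he⟩
          have := ih2.injOn ⟨hk.1.trans hki, hih⟩ hl (he.trans hlu.symm)
          omega
        · exact fun hkl => ⟨l, hkl, hl.2, hlu⟩
      simp only [shiftSeq, σ, hiff]
      split_ifs
      · rfl
      · exact hlu.symm
      · rfl
      · rfl
    have hσmaps : Set.MapsTo σ (Set.Icc 1 h) (Set.Icc 1 h) := by
      intro k hk
      obtain ⟨h1, h2⟩ := hk
      obtain ⟨h3, h4⟩ := hl
      simp only [σ, Set.mem_Icc]
      split_ifs <;> omega
    have hσinj : Set.InjOn σ (Set.Icc 1 h) := by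
      intro k hk i hi he
      obtain ⟨h1, h2⟩ := hk
      obtain ⟨h3, h4⟩ := hi
      simp only [σ] at he
      split_ifs at he <;> omega
    have hσbij : Set.BijOn σ (Set.Icc 1 h) (Set.Icc 1 h) :=
      ((Set.finite_Icc 1 h).injOn_iff_bijOn_of_mapsTo hσmaps).1 hσinj
    refine ⟨fun k h1 h2 => ?_, ?_, ?_⟩
    · rcases Nat.lt_or_ge j k with hjk | hjk
      · obtain rfl : k = j + 1 := by omega
        simp [shiftSeq]
      · rw [← ih1 k h1 hjk]
        simp [shiftSeq, hjk]
    · exact (ih2.comp hσbij).congr fun k hk => (hσ k hk).symm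
    · intro k hk i hi hki
      obtain ⟨h1, h2⟩ := hk
      obtain ⟨h3, h4⟩ := hi
      obtain ⟨h5, h6⟩ := hl
      simp only
      rw [hσ k ⟨by omega, h2⟩, hσ i ⟨by omega, h4⟩]
      refine ih3 ?_ ?_ ?_
      · simp only [σ, Set.mem_Ioc]
        split_ifs <;> omega
      · simp only [σ, Set.mem_Ioc]
        split_ifs <;> omega
      · simp only [σ]
        split_ifs <;> omega

end Arrangement

/-! ### Raising the branch values one after another -/

section Raising

/-- The values `F 0` are raised to `a` one after another, in the order `u 1, ..., u h`. -/
structure IsRaising {V : Type*} (N : Finset V) (h : ℕ) (u : ℕ → V) (a : V → ℝ)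
    (F : ℕ → V → ℝ) : Prop where
  bijOn : Set.BijOn u (Set.Icc 1 h) N
  antitone : AntitoneOn (fun k => a (u k)) (Set.Icc 1 h)
  nonneg : ∀ v ∈ N, 0 ≤ F 0 v
  le : ∀ v ∈ N, F 0 v ≤ a v
  raised : ∀ j k, 1 ≤ k → k ≤ j → j ≤ h → F j (u k) = a (u k)
  unraised : ∀ j k, j < k → k ≤ h → F j (u k) = F 0 (u k)

variable {V : Type*} {ρ : ℝ} {N : Finset V} {h : ℕ} {u Q₀ : ℕ → V} {a : V → ℝ} {F : ℕ → V → ℝ}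

lemma IsRaising.step_le (H : IsRaising N h u a F) {i j : ℕ} (hij : i ≤ j) (hj : j ≤ h) {v : V}
    (hv : v ∈ N) : F i v ≤ F j v := by
  obtain ⟨k, hk, rfl⟩ := H.bijOn.surjOn hv
  rcases Nat.lt_or_ge j k with h1 | h1
  · rw [H.unraised j k h1 hk.2, H.unraised i k (by omega) hk.2]
  · rw [H.raised j k hk.1 h1 hj]
    rcases Nat.lt_or_ge i k with h2 | h2
    · rw [H.unraised i k h2 hk.2]
      exact H.le _ hv
    · rw [H.raised i k hk.1 h2 (by omega)]

/-- The prefix is sorted by `a` and the tail by `F 0`. Across the boundary, an unraised value is at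
most its own target, which is at most every target in the prefix. -/
lemma IsRaising.antitone_shiftSeq (H : IsRaising N h u a F)
    (hQ : Set.BijOn Q₀ (Set.Icc 1 h) N)
    (hanti : AntitoneOn (fun k => F 0 (Q₀ k)) (Set.Icc 1 h)) {j : ℕ} (hj : j ≤ h) :
    AntitoneOn (fun k => F j (shiftSeq h u Q₀ j k)) (Set.Icc 1 h) := by
  obtain ⟨h1, h2, h3⟩ := shiftSeq_spec (f := F 0) H.bijOn hQ hanti j hj
  have hlate : ∀ k, j < k → k ≤ h → ∃ m, j < m ∧ m ≤ h ∧ shiftSeq h u Q₀ j k = u m := by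
    intro k hjk hkh
    obtain ⟨m, hm, hmk⟩ := H.bijOn.surjOn (h2.mapsTo (show k ∈ Set.Icc 1 h from ⟨by omega, hkh⟩))
    refine ⟨m, ?_, hm.2, hmk.symm⟩
    by_contra! hc
    rw [← h1 m hm.1 hc] at hmk
    have := h2.injOn hm ⟨by omega, hkh⟩ hmk
    omega
  intro i hi k hk hik
  simp only
  rcases Nat.lt_or_ge j k with hjk | hjk
  · obtain ⟨m, hjm, hmh, hm⟩ := hlate k hjk hk.2
    rcases Nat.lt_or_ge j i with hji | hji
    · obtain ⟨m', hjm', hmh', hm'⟩ := hlate i hji hi.2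
      have := h3 ⟨hji, hi.2⟩ ⟨hjk, hk.2⟩ hik
      simp only at this
      rw [hm, hm'] at this ⊢
      rw [H.unraised j m hjm hmh, H.unraised j m' hjm' hmh']
      exact this
    · rw [hm, h1 i hi.1 hji, H.unraised j m hjm hmh, H.raised j i hi.1 hji hj]
      have hmI : m ∈ Set.Icc 1 h := ⟨by omega, hmh⟩
      exact (H.le _ (H.bijOn.mapsTo hmI)).trans (H.antitone hi hmI (by omega))
  · rw [h1 i hi.1 (by omega), h1 k hk.1 hjk, H.raised j i hi.1 (by omega) hj,
      H.raised j k hk.1 hjk hj]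
    exact H.antitone hi hk hik

/-- There is a first step at which the raised receiver is also the first critical one. -/
lemma IsRaising.exists_isLeast (H : IsRaising N h u a F) (hρ : 0 ≤ ρ) (hh : 1 ≤ h)
    (hQ : Set.BijOn Q₀ (Set.Icc 1 h) N)
    (hanti : AntitoneOn (fun k => F 0 (Q₀ k)) (Set.Icc 1 h)) :
    ∃ t, IsLeast {j | j ∈ Set.Icc 1 h ∧ IsLeast {k | k ∈ Set.Icc 1 h ∧
        callTime ρ N (F j) = k * ρ + F j (shiftSeq h u Q₀ j k)} j} t ∧
      callTime ρ N (F t) = t * ρ + a (u t) ∧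
      ∀ j < t, ∀ k, 1 ≤ k → k ≤ j → k * ρ + a (u k) < callTime ρ N (F j) := by
  set S : Set ℕ := {j | j ∈ Set.Icc 1 h ∧ IsLeast {k | k ∈ Set.Icc 1 h ∧
        callTime ρ N (F j) = k * ρ + F j (shiftSeq h u Q₀ j k)} j} with hS
  -- Until the process stops, no raised receiver is critical. Old strict inequalities survive
  -- because `callTime` only grows; equality at the new position `j + 1` would make it the first
  -- critical one, so `j + 1 ∈ S`.
  have key : ∀ j ≤ h, (∀ i ≤ j, i ∉ S) →
      ∀ k, 1 ≤ k → k ≤ j → k * ρ + a (u k) < callTime ρ N (F j) := by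
    intro j hj hi
    induction j with
    | zero => intro k h1 h2; omega
    | succ j ih =>
      have ih' := ih (by omega) fun i hij => hi i (by omega)
      have hlt : ∀ k, 1 ≤ k → k ≤ j → k * ρ + a (u k) < callTime ρ N (F (j + 1)) :=
        fun k h1 h2 => (ih' k h1 h2).trans_le
          (callTime_mono hρ subset_rfl fun v hv => H.step_le (by omega) hj hv)
      obtain ⟨s1, s2, -⟩ := shiftSeq_spec (f := F 0) H.bijOn hQ hanti (j + 1) hj
      intro k h1 h2
      rcases Nat.lt_or_ge j k with hjk | hjk
      · obtain rfl : k = j + 1 := by omega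
        have hmem : j + 1 ∈ Set.Icc 1 h := ⟨h1, hj⟩
        have hle := mul_add_le_callTime hρ s2 (H.antitone_shiftSeq hQ hanti hj) hmem
        rw [s1 _ h1 le_rfl, H.raised _ _ h1 le_rfl hj] at hle
        refine lt_of_le_of_ne hle fun he => hi (j + 1) le_rfl ⟨hmem, ⟨hmem, ?_⟩, ?_⟩
        · rw [s1 _ h1 le_rfl, H.raised _ _ h1 le_rfl hj]
          exact he.symm
        · rintro m ⟨hm, hme⟩
          by_contra! hc
          rw [s1 m hm.1 (by omega), H.raised _ _ hm.1 (by omega) hj] at hme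
          exact (hlt m hm.1 (by omega)).ne' hme
      · exact hlt k h1 hjk
  have hne : S.Nonempty := by
    by_contra hemp
    rw [Set.not_nonempty_iff_eq_empty] at hemp
    -- After `h` steps everything is raised, yet some position must be critical.
    have h1 := key h le_rfl fun i _ => by simp [hemp]
    obtain ⟨s1, s2, -⟩ := shiftSeq_spec (f := F 0) H.bijOn hQ hanti h le_rfl
    obtain ⟨k, hk, he⟩ := exists_callTime_eq_position hρ s2 (H.antitone_shiftSeq hQ hanti le_rfl) hh
      fun v hv => (H.nonneg v hv).trans (H.step_le (Nat.zero_le _) le_rfl hv)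
    rw [s1 k hk.1 hk.2, H.raised _ _ hk.1 hk.2 le_rfl] at he
    exact (h1 k hk.1 hk.2).ne' he
  obtain ⟨t, ht⟩ := exists_isLeast_nat hne
  refine ⟨t, ht, ?_, fun j hjt => key j (by have := ht.1.1.2; omega) fun i hij his => ?_⟩
  · obtain ⟨htI, ht1, -⟩ := ht.1
    obtain ⟨s1, -, -⟩ := shiftSeq_spec (f := F 0) H.bijOn hQ hanti t htI.2
    rw [ht1.2, s1 t htI.1 le_rfl, H.raised _ _ htI.1 le_rfl htI.2]
  · have := ht.2 his
    omega

/-- The critical value before raising is at most the value of the receiver raised last. -/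
lemma IsRaising.critical_le (H : IsRaising N h u a F) (hρ : 0 ≤ ρ) {t : ℕ}
    (ht : t ∈ Set.Icc 1 h)
    (hlt : ∀ j < t, ∀ k, 1 ≤ k → k ≤ j → k * ρ + a (u k) < callTime ρ N (F j))
    {A : Finset V} (hAN : A ⊆ N) (hA : A.Nonempty) {φ : ℝ} (hφ : ∀ w ∈ A, φ ≤ F 0 w)
    (hcrit : callTime ρ N (F 0) ≤ A.card * ρ + φ) : φ ≤ a (u t) := by
  classical
  by_contra! hat
  -- The last index up to `t` with target at least `φ`. All of `A` has index at most `t'`, and `t' <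
  -- t`. The critical receiver at stage `t'` will contradict `hlt`.
  set t' := Nat.findGreatest (fun k => 1 ≤ k ∧ φ ≤ a (u k)) t with ht'
  have hlow : ∀ k, t' < k → k ≤ h → a (u k) < φ := by
    intro k hk hkh
    rcases Nat.lt_or_ge t k with h1 | h1
    · exact (H.antitone ht ⟨by omega, hkh⟩ h1.le).trans_lt hat
    · by_contra! hc
      exact Nat.findGreatest_is_greatest hk h1 ⟨by omega, hc⟩
  have hAt : ∀ k ∈ Set.Icc 1 h, u k ∈ A → k ≤ t' := by
    intro k hk hkA
    by_contra! hc
    have := hlow k hc hk.2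
    linarith [hφ _ hkA, H.le _ (hAN hkA)]
  obtain ⟨w, hw⟩ := hA
  obtain ⟨k, hk, rfl⟩ := H.bijOn.surjOn (hAN hw)
  have hkt' := hAt k hk hw
  have hspec : 1 ≤ t' ∧ φ ≤ a (u t') :=
    Nat.findGreatest_of_ne_zero (P := fun k => 1 ≤ k ∧ φ ≤ a (u k)) ht'.symm
      (by have := hk.1; omega)
  have htt : t' < t := by
    refine lt_of_le_of_ne (Nat.findGreatest_le t) fun he => ?_
    rw [he] at hspec
    linarith [hspec.2]
  have ht'h : t' ≤ h := htt.le.trans ht.2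
  obtain ⟨v, hv, he⟩ := exists_callTime_eq (f := F t') ⟨_, hAN hw⟩ hρ
    fun v hv => (H.nonneg v hv).trans (H.step_le (Nat.zero_le _) ht'h hv)
  set C := N.filter fun w => F t' v ≤ F t' w with hC
  have hvC : v ∈ C := by simp [hC, hv]
  obtain ⟨m, hm, rfl⟩ := H.bijOn.surjOn hv
  rcases Nat.lt_or_ge t' m with hmt | hmt
  · have hψ := H.unraised t' m hmt hm.2
    have hψφ : F 0 (u m) < φ := (H.le _ hv).trans_lt (hlow m hmt hm.2)
    -- The critical receiver is unraised here. The late part `D` of its critical set is disjoint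
    -- from `A`, so `D ∪ A` tested against `F 0` gives `D.card * ρ + F 0 (u m) ≤ φ`. Hence `callTime
    -- ρ N (F t')` is at most `t' * ρ + a (u t')`.
    set D := C.filter fun w => w ∉ (Finset.Icc 1 t').image u with hD
    have hCcard : C.card ≤ t' + D.card := by
      have h1 : C ⊆ (Finset.Icc 1 t').image u ∪ D := by
        intro w hw
        by_cases hwu : w ∈ (Finset.Icc 1 t').image u
        · exact Finset.mem_union_left _ hwu
        · exact Finset.mem_union_right _ (Finset.mem_filter.2 ⟨hw, hwu⟩)
      have h2 := (Finset.card_le_card h1).trans (Finset.card_union_le _ _)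
      have h3 : ((Finset.Icc 1 t').image u).card ≤ t' := Finset.card_image_le.trans (by simp)
      omega
    have hDval : ∀ w ∈ D, w ∈ N ∧ F 0 (u m) ≤ F 0 w ∧ w ∉ A := by
      intro w hw
      obtain ⟨hwC, hwu⟩ := Finset.mem_filter.1 hw
      obtain ⟨hwN, hwF⟩ := Finset.mem_filter.1 hwC
      obtain ⟨i, hi, rfl⟩ := H.bijOn.surjOn hwN
      have hit : t' < i := by
        by_contra! hc
        exact hwu (Finset.mem_image_of_mem _ (Finset.mem_Icc.2 ⟨hi.1, hc⟩))
      rw [hψ, H.unraised t' i hit hi.2] at hwF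
      exact ⟨hwN, hwF, fun hiA => by have := hAt i hi hiA; omega⟩
    have hdisj : Disjoint D A := Finset.disjoint_left.2 fun w hw => (hDval w hw).2.2
    have h1 := card_mul_add_le_callTime (f := F 0) (N := N) (A := D ∪ A) (θ := F 0 (u m)) hρ
      (Finset.union_subset (fun w hw => (hDval w hw).1) hAN)
      ⟨_, Finset.mem_union_right _ hw⟩ (fun w hw => by
        rcases Finset.mem_union.1 hw with h | h
        · exact (hDval w h).2.1
        · linarith [hφ w h])
    rw [Finset.card_union_of_disjoint hdisj] at h1
    have h2 := hlt t' htt t' hspec.1 le_rfl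
    rw [he, hψ] at h2
    have h3 : (C.card : ℝ) ≤ t' + D.card := by exact_mod_cast hCcard
    have h4 := mul_le_mul_of_nonneg_right h3 hρ
    push_cast at h1
    linarith [hspec.2]
  · have hψ := H.raised t' m hm.1 hmt ht'h
    have hψφ : φ ≤ a (u m) :=
      hspec.2.trans (H.antitone hm ⟨hspec.1, ht'h⟩ hmt)
    have hCval : ∀ w ∈ C, a (u m) ≤ a w ∧ w ∈ (Finset.Icc 1 t').image u := by
      intro w hw
      obtain ⟨hwN, hwF⟩ := Finset.mem_filter.1 hw
      obtain ⟨i, hi, rfl⟩ := H.bijOn.surjOn hwN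
      rw [hψ] at hwF
      have hit : i ≤ t' := by
        by_contra! hc
        rw [H.unraised t' i hc hi.2] at hwF
        linarith [hlow i hc hi.2, H.le _ hwN]
      rw [H.raised t' i hi.1 hit ht'h] at hwF
      exact ⟨hwF, Finset.mem_image_of_mem _ (Finset.mem_Icc.2 ⟨hi.1, hit⟩)⟩
    -- The critical receiver is raised, and so is all of `C`. Then position `C.card ≤ t'` has target
    -- at least `a (u m)` and is critical, against `hlt`.
    have hCt : C.card ≤ t' :=
      (Finset.card_le_card fun w hw => (hCval w hw).2).trans
        (Finset.card_image_le.trans (by simp))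
    have h1 := le_apply_card H.bijOn H.antitone (Finset.filter_subset _ _) ⟨_, hvC⟩
      fun w hw => (hCval w hw).1
    have h2 := hlt t' htt C.card (Finset.card_pos.2 ⟨_, hvC⟩) hCt
    rw [he, hψ] at h2
    linarith

/-- Raising the values costs at least as much without the receiver `m` as with it. -/
lemma IsRaising.callTime_insert_le [DecidableEq V] (H : IsRaising N h u a F) (hρ : 0 ≤ ρ) {t : ℕ}
    (ht : t ∈ Set.Icc 1 h)
    (hlt : ∀ j < t, ∀ k, 1 ≤ k → k ≤ j → k * ρ + a (u k) < callTime ρ N (F j))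
    {A : Finset V} (hAN : A ⊆ N) (hA : A.Nonempty) {φ : ℝ} (hφ : ∀ w ∈ A, φ ≤ F 0 w)
    (hcrit : callTime ρ N (F 0) ≤ A.card * ρ + φ) {m : V} (hm : F t m = F 0 m)
    (hmφ : F 0 m < φ) :
    callTime ρ (insert m N) (F t) ≤
      callTime ρ (insert m N) (F 0) + (callTime ρ N (F t) - callTime ρ N (F 0)) := by
  have hat := H.critical_le hρ ht hlt hAN hA hφ hcrit
  have hstep : ∀ v ∈ N, F 0 v ≤ F t v := fun v hv => H.step_le (Nat.zero_le _) ht.2 hv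
  have hΔ : callTime ρ N (F 0) ≤ callTime ρ N (F t) := callTime_mono hρ subset_rfl hstep
  have hins : callTime ρ N (F 0) ≤ callTime ρ (insert m N) (F 0) :=
    callTime_mono hρ (Finset.subset_insert _ _) fun _ _ => le_rfl
  have h0 : 0 ≤ callTime ρ N (F 0) := callTime_nonneg
  refine callTime_le_iff.2 ⟨by linarith, fun v hv => ?_⟩
  -- If `v` exceeds `m`, then `m` is not counted and the bound for `N` alone suffices. Otherwise the
  -- count for `v` grows only by the set `E` of receivers lifted past `θ`. These end at `φ` or
  -- above, so together with `A` they force `callTime ρ N` to grow by at least `E.card * ρ`.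
  rcases lt_or_ge (F 0 m) (F t v) with hvm | hvm
  · have hvN : v ∈ N := by
      rcases Finset.mem_insert.1 hv with rfl | h
      · exact absurd hm hvm.ne'
      · exact h
    have hfil : (insert m N).filter (fun w => F t v ≤ F t w) ⊆ N := by
      intro w hw
      obtain ⟨hw1, hw2⟩ := Finset.mem_filter.1 hw
      rcases Finset.mem_insert.1 hw1 with rfl | h
      · rw [hm] at hw2
        linarith
      · exact h
    have := card_mul_add_le_callTime (f := F t) hρ hfil ⟨v, by simp [hv]⟩
      fun w hw => (Finset.mem_filter.1 hw).2
    linarith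
  · set θ := F t v
    set E := N.filter fun w => F 0 w < θ ∧ θ ≤ F t w with hE
    set C₀ := (insert m N).filter fun w => θ ≤ F 0 w with hC₀
    have hC : (insert m N).filter (fun w => θ ≤ F t w) ⊆ C₀ ∪ E := by
      intro w hw
      obtain ⟨hw1, hw2⟩ := Finset.mem_filter.1 hw
      rcases lt_or_ge (F 0 w) θ with h | h
      · refine Finset.mem_union_right _ (Finset.mem_filter.2 ⟨?_, h, hw2⟩)
        rcases Finset.mem_insert.1 hw1 with rfl | h'
        · linarith
        · exact h'
      · exact Finset.mem_union_left _ (Finset.mem_filter.2 ⟨hw1, h⟩)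
    have hcard : (((insert m N).filter fun w => θ ≤ F t w).card : ℝ) ≤ C₀.card + E.card := by
      exact_mod_cast (Finset.card_le_card hC).trans (Finset.card_union_le _ _)
    have hdisj : Disjoint E A := Finset.disjoint_left.2 fun w hw hwA => by
      have := (Finset.mem_filter.1 hw).2.1
      linarith [hφ w hwA]
    have h1 := card_mul_add_le_callTime (f := F t) (N := N) (A := E ∪ A) (θ := φ) hρ
      (Finset.union_subset (Finset.filter_subset _ _) hAN)
      (hA.mono Finset.subset_union_right) (fun w hw => by
        rcases Finset.mem_union.1 hw with h | h
        · obtain ⟨hwN, hw1, hw2⟩ := Finset.mem_filter.1 h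
          obtain ⟨k, hk, rfl⟩ := H.bijOn.surjOn hwN
          rcases Nat.lt_or_ge t k with htk | htk
          · rw [H.unraised t k htk hk.2] at hw2
            linarith
          · rw [H.raised t k hk.1 htk ht.2]
            exact hat.trans (H.antitone hk ht htk)
        · exact (hφ w h).trans (hstep w (hAN h)))
    have h2 := card_mul_add_le_callTime (f := F 0) (N := insert m N) (A := C₀) (θ := θ) hρ
      (Finset.filter_subset _ _) ⟨m, by simp [hC₀, hvm]⟩ fun w hw => (Finset.mem_filter.1 hw).2
    rw [Finset.card_union_of_disjoint hdisj] at h1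
    push_cast at h1
    have h3 := mul_le_mul_of_nonneg_right hcard hρ
    linarith

end Raising

end Broadcast

namespace Broadcast

/-! ### The base scenario and the first two transformations -/

section Scenarios

variable {V : Type*} {G : SimpleGraph V} {ρ : ℝ} {s s' lo hi : Weights G}

lemma baseScenario_mem (hlohi : ∀ e, lo e ≤ hi e) (x y : V) :
    baseScenario lo hi x y ∈ scenarios lo hi := by
  intro e
  rw [baseScenario]
  split_ifs
  · exact ⟨hlohi e, le_rfl⟩
  · exact ⟨le_rfl, hlohi e⟩

lemma betaScenario_mem (hlohi : ∀ e, lo e ≤ hi e) (x y : V) (u : ℕ → V) (j : ℕ) :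
    betaScenario lo hi x y u j ∈ scenarios lo hi := by
  intro e
  rw [betaScenario]
  split_ifs
  · exact ⟨le_rfl, hlohi e⟩
  · exact baseScenario_mem hlohi x y e

lemma gammaScenario_mem (hlohi : ∀ e, lo e ≤ hi e) (hs : s ∈ scenarios lo hi) (x y : V)
    (u : ℕ → V) (j : ℕ) : gammaScenario lo hi s x y u j ∈ scenarios lo hi := by
  intro e
  rw [gammaScenario]
  split_ifs
  · exact baseScenario_mem hlohi x y e
  · exact hs e

lemma baseScenario_of_mem_pathEdges {x y : V} {e : G.edgeSet} (he : e ∈ pathEdges G x y) :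
    baseScenario lo hi x y e = hi e := if_pos (Or.inl he)

lemma baseScenario_of_mem_edgesIn {x y : V} {e : G.edgeSet}
    (he : e ∈ edgesIn G (closedBranch G y x)) : baseScenario lo hi x y e = hi e :=
  if_pos (Or.inr he)

lemma baseScenario_of_notMem {x y : V} {e : G.edgeSet} (he : e ∉ pathEdges G x y)
    (he' : e ∈ edgesIn G (openBranch G y x)) : baseScenario lo hi x y e = lo e := by
  refine if_neg ?_
  rintro (h | h)
  · exact he h
  · obtain ⟨⟨a, b⟩, hab⟩ := e
    exact h a (by simp) (he' a (by simp))

lemma betaScenario_branchDeg (x y : V) (u : ℕ → V) :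
    betaScenario lo hi x y u (branchDeg G x y) = baseScenario lo hi x y := by
  funext e
  refine if_neg ?_
  rintro ⟨k, h1, h2, -⟩
  omega

lemma gammaScenario_zero (x y : V) (u : ℕ → V) : gammaScenario lo hi s x y u 0 = s := by
  funext e
  refine if_neg ?_
  rintro ⟨k, h1, h2, -⟩
  omega

lemma pathCost_congr {x y : V} (h : ∀ e ∈ pathEdges G x y, s' e = s e) :
    pathCost ρ s' x y = pathCost ρ s x y := by
  rw [pathCost, pathCost, pathWeight, pathWeight, finsum_mem_congr rfl h]

lemma branchValue_openBranch (hG : G.IsTree) {x y m : V} (hm : G.Adj y m)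
    (hmo : m ∈ openBranch G y x) :
    wt s y m + bTime ρ s m (openBranch G y x) = branchValue ρ s y m := by
  rw [openBranch_eq_of_mem hmo, openBranch_eq_closedBranch hG hm, branchValue]

variable [Fintype V]

lemma branchNbrs_eq (hG : G.IsTree) {x y m : V} (hm : G.Adj y m) (hmo : m ∈ openBranch G y x) :
    branchNbrs G x y = nbrs G y m := by
  ext v
  rw [Finset.mem_coe, mem_nbrs]
  refine and_congr_right fun hv => ?_
  rw [closedBranch, Set.mem_compl_iff, not_iff_not]
  constructor
  · intro hvo
    exact parent_unique hG hv hm ((mem_openBranch_adj_iff hG hv).1 hvo)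
      ((mem_openBranch_adj_iff hG hm).1 hmo)
  · rintro rfl
    exact hmo

lemma bTime_branch (hG : G.IsTree) (hρ : 0 < ρ) (hs : ∀ e, 0 ≤ s e) {x y m : V}
    (hm : G.Adj y m) (hmo : m ∈ openBranch G y x) :
    bTime ρ s y (closedBranch G y x) = callTime ρ (nbrs G y m) (branchValue ρ s y) := by
  rw [closedBranch_eq_of_mem hmo, bTime_closedBranch hG hρ hs (Or.inr hm)]

lemma criterion_eq_callTime [DecidableEq V] (hG : G.IsTree) (hρ : 0 < ρ) (hs : ∀ e, 0 ≤ s e)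
    {x y m : V} (hm : G.Adj y m) (hmo : m ∈ openBranch G y x) :
    criterion ρ s x y = pathCost ρ s x y + callTime ρ (nbrs G y m) (branchValue ρ s y) -
      callTime ρ (insert m (nbrs G y m)) (branchValue ρ s y) := by
  rw [criterion_eq, bTime_branch hG hρ hs hm hmo, bTime_univ hG hρ hs, nbrs_self_eq_insert hm]

/-- The first transformation. -/
theorem first_transformation (hG : G.IsTree) (hρ : 0 < ρ) (hlo : ∀ e, 0 ≤ lo e)
    (hlohi : ∀ e, lo e ≤ hi e) {x y : V} (hs : IsWorstCase ρ lo hi x s) (hyx : y ≠ x)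
    (hy : IsPrimeCenter ρ s y)
    (h1 : ∀ e ∈ pathEdges G x y ∪ edgesIn G (openBranch G y x), s' e = baseScenario lo hi x y e)
    (h2 : ∀ e, e ∉ pathEdges G x y ∪ edgesIn G (openBranch G y x) → s' e = s e) :
    IsWorstCase ρ lo hi x s' ∧ IsCenter ρ s' y := by
  classical
  have := Fintype.ofFinite G.edgeSet
  obtain ⟨m, hm, hd⟩ := exists_parent hG hyx
  have hmo := (mem_openBranch_adj_iff hG hm).2 hd
  have hs' : s' ∈ scenarios lo hi := by
    intro e
    by_cases he : e ∈ pathEdges G x y ∪ edgesIn G (openBranch G y x)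
    · rw [h1 e he]
      exact baseScenario_mem hlohi x y e
    · rw [h2 e he]
      exact hs.1 e
  have hs0 := nonneg_of_mem_scenarios hlo hs.1
  have hs0' := nonneg_of_mem_scenarios hlo hs'
  have hweight : ∀ s : Weights G, pathWeight s x y =
      ∑ e ∈ Finset.univ.filter (· ∈ pathEdges G x y), s e := by
    intro s
    rw [pathWeight, ← finsum_mem_coe_finset]
    exact finsum_mem_congr (by simp) fun _ _ => rfl
  have hb := bTime_le_add_sum hG hρ hs0 hs0' y y (Or.inl rfl)
  -- Only path edges increase, so the total increase is exactly the gain in path weight.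
  have hsum : ∑ e ∈ Finset.univ.filter (· ∈ edgesIn G (closedBranch G y y)),
      max (s' e - s e) 0 = pathWeight s' x y - pathWeight s x y := by
    rw [hweight, hweight, ← Finset.sum_sub_distrib, Finset.sum_filter, Finset.sum_filter]
    refine Finset.sum_congr rfl fun e _ => ?_
    rw [closedBranch_self, if_pos (show e ∈ edgesIn G Set.univ from fun _ _ => Set.mem_univ _)]
    by_cases he : e ∈ pathEdges G x y
    · rw [if_pos he, h1 e (Or.inl he), baseScenario_of_mem_pathEdges he]
      exact max_eq_left (sub_nonneg.2 (hs.1 e).2)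
    · rw [if_neg he]
      by_cases he' : e ∈ edgesIn G (openBranch G y x)
      · rw [h1 e (Or.inr he'), baseScenario_of_notMem he he']
        exact max_eq_right (sub_nonpos.2 (hs.1 e).1)
      · rw [h2 e (by simp [he, he']), sub_self, max_self]
  rw [hsum, closedBranch_self] at hb
  have hg : bTime ρ s' y (closedBranch G y x) = bTime ρ s y (closedBranch G y x) := by
    rw [bTime_branch hG hρ hs0 hm hmo, bTime_branch hG hρ hs0' hm hmo]
    refine callTime_congr hρ.le fun v hv => ?_
    rw [mem_nbrs] at hv
    refine branchValue_congr hG hρ hs0 hs0' hv.1 fun e he => h2 e ?_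
    rw [pathEdges_union_edgesIn hG hm hmo]
    exact branchEdges_disjoint hG hv.1 hm hv.2 he
  have hR := hs.isGreatest hy.1
  have hle : regret ρ s x y ≤ regret ρ s' x y := by
    have c1 := criterion_eq_regret hG hρ hs0 hyx hy
    have c2 := criterion_le_regret hG hρ hs0' x y
    rw [criterion_eq, pathCost] at c1 c2
    linarith
  -- A vertex faster than `y` under `s'` would push the regret above its maximum.
  refine ⟨isWorstCase_of_le hR hs' hle, fun z => ?_⟩
  have := hR.2 ⟨s', hs', z, rfl⟩
  rw [regret, regret] at *
  linarith

/-- The second transformation. -/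
theorem second_transformation (hG : G.IsTree) (hρ : 0 < ρ) (hlo : ∀ e, 0 ≤ lo e)
    (hlohi : ∀ e, lo e ≤ hi e) {x : V}
    (hx : ∀ s, IsWorstCase ρ lo hi x s → ¬ IsPrimeCenter ρ s x) :
    ∃ s y, IsWorstCase ρ lo hi x s ∧ y ≠ x ∧ IsPrimeCenter ρ s y ∧
      ∀ e ∈ pathEdges G x y ∪ edgesIn G (openBranch G y x), s e = baseScenario lo hi x y e := by
  classical
  have hne : {y | ∃ s, IsWorstCase ρ lo hi x s ∧ IsPrimeCenter ρ s y}.Nonempty := by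
    obtain ⟨s, hs⟩ := exists_isWorstCase hG hρ hlo hlohi x
    obtain ⟨y, hy⟩ := exists_isPrimeCenter (ρ := ρ) hG hρ (nonneg_of_mem_scenarios hlo hs.1)
    exact ⟨y, s, hs, hy⟩
  -- The first transformation keeps `y` a center but perhaps not a prime one. Maximal distance from
  -- `x` forces a new prime center to be `y` or its neighbour toward `x`.
  obtain ⟨y, ⟨s, hs, hy⟩, hmax⟩ := Set.exists_max_image _ (fun y => G.dist x y)
    (Set.toFinite _) hne
  have hyx : y ≠ x := by
    rintro rfl
    exact hx s hs hy
  let s' : Weights G := fun e =>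
    if e ∈ pathEdges G x y ∪ edgesIn G (openBranch G y x) then baseScenario lo hi x y e else s e
  have h1 : ∀ e ∈ pathEdges G x y ∪ edgesIn G (openBranch G y x),
      s' e = baseScenario lo hi x y e := fun e he => if_pos he
  obtain ⟨hw, hc⟩ := first_transformation hG hρ hlo hlohi hs hyx hy h1 fun e he => if_neg he
  have hs0' := nonneg_of_mem_scenarios hlo hw.1
  obtain ⟨k, hk⟩ := exists_isPrimeCenter (ρ := ρ) hG hρ hs0'
  have hkx : k ≠ x := by
    rintro rfl
    exact hx s' hw hk
  refine ⟨s', k, hw, hkx, hk, ?_⟩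
  rcases hc.eq_or_adj hG hρ hs0' hk with rfl | hadj
  · exact h1
  · have hle := hmax k ⟨s', hw, hk⟩
    have hd : G.dist x y = G.dist x k + 1 := by
      have := dist_adj_cases hG x hadj
      omega
    have hko := (mem_openBranch_adj_iff hG hadj.symm).2 hd
    have hsub : openBranch G k x ⊆ openBranch G y x := by
      obtain ⟨p, hp, hpc, -, hpu⟩ := exists_toward hG x k
      have h3 := closedBranch_child_subset hG hp hadj
        (mem_nbrs.1 (mem_nbrs_of_toward hG hadj.symm hko hpu)).2
      rw [← hpc, ← closedBranch_eq_of_mem hko] at h3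
      exact Set.compl_subset_compl.1 h3
    have hpath := pathEdges_eq_insert hG hadj.symm hko
    rintro e he
    by_cases hep : e ∈ pathEdges G x k
    · have hep' : e ∈ pathEdges G x y := by
        rw [hpath]
        exact Or.inr hep
      rw [h1 e (Or.inl hep'), baseScenario_of_mem_pathEdges hep, baseScenario_of_mem_pathEdges hep']
    · have heo := he.resolve_left hep
      have hep' : e ∉ pathEdges G x y := by
        rw [hpath]
        rintro (rfl | h)
        · exact mem_closedBranch_root k x (heo k (by simp))
        · exact hep h
      rw [h1 e (Or.inr (edgesIn_mono hsub heo)), baseScenario_of_notMem hep heo,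
        baseScenario_of_notMem hep' (edgesIn_mono hsub heo)]

/-- If `y` had only the neighbour `m`, its time away from `m` would be `0`. Balance would then leave
`m` no other neighbour, so the tree would be the single edge between `x` and `y`, and `x` would be
prime as well. -/
lemma nbrs_nonempty (hG : G.IsTree) (hρ : 0 < ρ) (hs : ∀ e, 0 ≤ s e) {x y m : V}
    (hm : G.Adj y m) (hmo : m ∈ openBranch G y x) (hy : IsPrimeCenter ρ s y)
    (hx : ¬ IsPrimeCenter ρ s x) : (nbrs G y m).Nonempty := by
  by_contra hemp
  rw [Finset.not_nonempty_iff_eq_empty] at hemp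
  have h0 : bTime ρ s y (closedBranch G y m) = 0 := by
    rw [bTime_closedBranch hG hρ hs (Or.inr hm), hemp]
    rfl
  have h1 := hy.2 m hm
  rw [h0, bTime_closedBranch hG hρ hs (Or.inr hm.symm)] at h1
  have h2 : ∀ v, G.Adj m v → v = y := by
    intro v hv
    by_contra hvy
    have h3 := add_le_callTime (f := branchValue ρ s m) hρ.le (mem_nbrs.2 ⟨hv, hvy⟩)
    have h4 := branchValue_nonneg hG hρ hs hv
    linarith
  have hmx : m = x := by
    by_contra hne
    obtain ⟨p, hp, hd⟩ := exists_parent hG hne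
    have h3 := (mem_openBranch_adj_iff hG hm).1 hmo
    rw [h2 p hp] at hd
    omega
  subst hmx
  refine hx (isPrimeCenter_of_balanced hG hρ hs fun u hu => ?_)
  rw [h2 u hu, h0]
  exact bTime_nonneg hG hρ hs (Or.inr hm.symm)

end Scenarios

/-! ### The third and fourth transformations -/

section Branches

variable {V : Type*} {G : SimpleGraph V} {ρ : ℝ} {s lo hi : Weights G}
  {x y m : V} {u : ℕ → V}

lemma exists_index_iff (hG : G.IsTree)
    (hu : Set.BijOn u (Set.Icc 1 (branchDeg G x y)) (branchNbrs G x y)) {k : ℕ}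
    (hk : k ∈ Set.Icc 1 (branchDeg G x y)) {e : G.edgeSet} (he : e ∈ branchEdges G y (u k))
    {i : ℕ} (hi : i ∈ Set.Icc 1 (branchDeg G x y)) : e ∈ branchEdges G y (u i) ↔ i = k := by
  constructor
  · intro h
    by_contra hne
    refine branchEdges_disjoint hG (hu.mapsTo hk).1 (hu.mapsTo hi).1 (fun h' => hne ?_) he h
    exact hu.injOn hi hk h'.symm
  · rintro rfl
    exact he

lemma notMem_branchEdges_index (hG : G.IsTree) (hm : G.Adj y m) (hmo : m ∈ openBranch G y x)
    (hu : Set.BijOn u (Set.Icc 1 (branchDeg G x y)) (branchNbrs G x y)) {e : G.edgeSet}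
    (he : e ∈ branchEdges G y m) {i : ℕ} (hi : i ∈ Set.Icc 1 (branchDeg G x y)) :
    e ∉ branchEdges G y (u i) := by
  have := hu.mapsTo hi
  refine branchEdges_disjoint hG hm this.1 ?_ he
  intro h
  rw [← h] at this
  exact this.2 hmo

lemma gammaScenario_apply_index (hG : G.IsTree)
    (hu : Set.BijOn u (Set.Icc 1 (branchDeg G x y)) (branchNbrs G x y)) {j k : ℕ}
    (hj : j ≤ branchDeg G x y) (hk : k ∈ Set.Icc 1 (branchDeg G x y)) {e : G.edgeSet}
    (he : e ∈ branchEdges G y (u k)) : gammaScenario lo hi s x y u j e =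
      if k ≤ j then baseScenario lo hi x y e else s e := by
  have : (∃ i, 1 ≤ i ∧ i ≤ j ∧ e ∈ branchEdges G y (u i)) ↔ k ≤ j := by
    constructor
    · rintro ⟨i, h1, h2, h3⟩
      rw [exists_index_iff hG hu hk he ⟨h1, h2.trans hj⟩] at h3
      omega
    · exact fun h => ⟨k, hk.1, h, he⟩
  simp only [gammaScenario, this]

lemma betaScenario_apply_index (hG : G.IsTree)
    (hu : Set.BijOn u (Set.Icc 1 (branchDeg G x y)) (branchNbrs G x y)) {j k : ℕ}
    (hk : k ∈ Set.Icc 1 (branchDeg G x y)) {e : G.edgeSet}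
    (he : e ∈ branchEdges G y (u k)) : betaScenario lo hi x y u j e =
      if j < k then lo e else baseScenario lo hi x y e := by
  have : (∃ i, j < i ∧ i ≤ branchDeg G x y ∧ e ∈ branchEdges G y (u i)) ↔ j < k := by
    constructor
    · rintro ⟨i, h1, h2, h3⟩
      rw [exists_index_iff hG hu hk he ⟨by omega, h2⟩] at h3
      omega
    · exact fun h => ⟨k, h, hk.2, he⟩
  simp only [betaScenario, this]

lemma gammaScenario_apply_toward (hG : G.IsTree) (hm : G.Adj y m) (hmo : m ∈ openBranch G y x)
    (hu : Set.BijOn u (Set.Icc 1 (branchDeg G x y)) (branchNbrs G x y)) {j : ℕ}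
    (hj : j ≤ branchDeg G x y) {e : G.edgeSet} (he : e ∈ branchEdges G y m) :
    gammaScenario lo hi s x y u j e = s e := by
  refine if_neg ?_
  rintro ⟨i, h1, h2, h3⟩
  exact notMem_branchEdges_index hG hm hmo hu he ⟨h1, h2.trans hj⟩ h3

lemma betaScenario_apply_toward (hG : G.IsTree) (hm : G.Adj y m) (hmo : m ∈ openBranch G y x)
    (hu : Set.BijOn u (Set.Icc 1 (branchDeg G x y)) (branchNbrs G x y)) {j : ℕ}
    {e : G.edgeSet} (he : e ∈ branchEdges G y m) :
    betaScenario lo hi x y u j e = baseScenario lo hi x y e := by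
  refine if_neg ?_
  rintro ⟨i, h1, h2, h3⟩
  exact notMem_branchEdges_index hG hm hmo hu he ⟨by omega, h2⟩ h3

lemma baseScenario_of_mem_branchEdges (hG : G.IsTree) (hm : G.Adj y m)
    (hmo : m ∈ openBranch G y x) {v : V} (hv : v ∈ branchNbrs G x y) {e : G.edgeSet}
    (he : e ∈ branchEdges G y v) : baseScenario lo hi x y e = hi e := by
  refine baseScenario_of_mem_edgesIn ?_
  rw [closedBranch_eq_of_mem hmo]
  refine branchEdges_subset_edgesIn hG (Or.inr hm) hv.1 ?_ he
  rintro rfl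
  exact hv.2 hmo

variable [Fintype V]

lemma isRaising_gamma (hG : G.IsTree) (hρ : 0 < ρ) (hlo : ∀ e, 0 ≤ lo e)
    (hlohi : ∀ e, lo e ≤ hi e) (hs : s ∈ scenarios lo hi)
    (hm : G.Adj y m) (hmo : m ∈ openBranch G y x)
    (hu : IsSortedArrangement ρ (baseScenario lo hi x y) x y u) :
    IsRaising (nbrs G y m) (branchDeg G x y) u (branchValue ρ (baseScenario lo hi x y) y)
      (fun j => branchValue ρ (gammaScenario lo hi s x y u j) y) := by
  have hs0 := nonneg_of_mem_scenarios hlo hs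
  have hα0 := nonneg_of_mem_scenarios hlo (baseScenario_mem hlohi x y)
  have hγ0 := fun j => nonneg_of_mem_scenarios hlo (gammaScenario_mem hlohi hs x y u j)
  have hN := branchNbrs_eq hG hm hmo
  refine ⟨hN ▸ hu.1, hu.2, fun v hv => ?_, fun v hv => ?_, fun j k h1 h2 h3 => ?_,
    fun j k h1 h2 => ?_⟩
  · exact branchValue_nonneg hG hρ (hγ0 0) (mem_nbrs.1 hv).1
  · have hv' : v ∈ branchNbrs G x y := by
      rw [hN]
      exact hv
    simp only [gammaScenario_zero]
    refine branchValue_mono hG hρ hα0 hs0 hv'.1 fun e he => ?_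
    rw [baseScenario_of_mem_branchEdges hG hm hmo hv' he]
    exact (hs e).2
  · have hk : k ∈ Set.Icc 1 (branchDeg G x y) := ⟨h1, h2.trans h3⟩
    refine branchValue_congr hG hρ hα0 (hγ0 j) (hu.1.mapsTo hk).1 fun e he => ?_
    rw [gammaScenario_apply_index hG hu.1 h3 hk he, if_pos h2]
  · have hk : k ∈ Set.Icc 1 (branchDeg G x y) := ⟨by omega, h2⟩
    simp only [gammaScenario_zero]
    refine branchValue_congr hG hρ hs0 (hγ0 j) (hu.1.mapsTo hk).1 fun e he => ?_
    rw [gammaScenario_apply_index hG hu.1 (by omega) hk he, if_neg (by omega)]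

/-- The third transformation: raising the weights of all branches away from `x`. -/
lemma criterion_le_criterion_base (hG : G.IsTree) (hρ : 0 < ρ) (hlo : ∀ e, 0 ≤ lo e)
    (hlohi : ∀ e, lo e ≤ hi e) (hs : s ∈ scenarios lo hi)
    (hm : G.Adj y m) (hmo : m ∈ openBranch G y x)
    (hagree : ∀ e ∈ branchEdges G y m, s e = baseScenario lo hi x y e)
    {A : Finset V} (hA : A ⊆ nbrs G y m) {φ : ℝ} (hφ : ∀ w ∈ A, φ ≤ branchValue ρ s y w)
    (hcrit : callTime ρ (nbrs G y m) (branchValue ρ s y) = A.card * ρ + φ)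
    (hle : φ ≤ branchValue ρ s y m) :
    criterion ρ s x y ≤ criterion ρ (baseScenario lo hi x y) x y := by
  classical
  have hs0 := nonneg_of_mem_scenarios hlo hs
  have hα0 := nonneg_of_mem_scenarios hlo (baseScenario_mem hlohi x y)
  have hN := branchNbrs_eq hG hm hmo
  rw [criterion_eq_callTime hG hρ hs0 hm hmo, criterion_eq_callTime hG hρ hα0 hm hmo,
    pathCost_congr fun e he => hagree e (pathEdges_subset_branchEdges hG hm hmo he)]
  have h1 : callTime ρ (nbrs G y m) (branchValue ρ s y) ≤
      callTime ρ (nbrs G y m) (branchValue ρ (baseScenario lo hi x y) y) := by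
    refine callTime_mono hρ.le subset_rfl fun v hv => ?_
    have hv' : v ∈ branchNbrs G x y := by
      rw [hN]
      exact hv
    refine branchValue_mono hG hρ hα0 hs0 hv'.1 fun e he => ?_
    rw [baseScenario_of_mem_branchEdges hG hm hmo hv' he]
    exact (hs e).2
  have h2 := callTime_insert_le (N := nbrs G y m) (m := m)
    (f := branchValue ρ (baseScenario lo hi x y) y) hρ.le
  have h3 := branchValue_congr hG hρ hα0 hs0 hm hagree
  rw [← h3] at h2
  have h4 := add_le_callTime (N := insert m (nbrs G y m)) (f := branchValue ρ s y) hρ.le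
    (Finset.mem_insert_self _ _)
  have h5 := card_mul_add_le_callTime (N := insert m (nbrs G y m)) (f := branchValue ρ s y)
    (A := insert m A) (θ := φ) hρ.le (Finset.insert_subset_insert _ hA)
    (Finset.insert_nonempty _ _) (fun w hw => by
      rcases Finset.mem_insert.1 hw with rfl | h
      · exact hle
      · exact hφ w h)
  rw [Finset.card_insert_of_notMem fun h => (mem_nbrs.1 (hA h)).2 rfl] at h5
  push_cast at h5
  -- Under `s` the tree time is at least `ρ + branchValue ρ s y m`, and also at least `ρ` plus the
  -- closed-branch time, since `m` joins the critical set `A`. Each alternative for the maximum is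
  -- covered by one of these.
  rcases max_cases (branchValue ρ s y m)
    (callTime ρ (nbrs G y m) (branchValue ρ (baseScenario lo hi x y) y)) with h | h
  · linarith
  · linarith

/-- The fourth transformation: the branches after the first critical one are lowered. -/
lemma criterion_le_criterion_beta [DecidableEq V] (hG : G.IsTree) (hρ : 0 < ρ) (hlo : ∀ e, 0 ≤ lo e)
    (hlohi : ∀ e, lo e ≤ hi e) (hs : s ∈ scenarios lo hi)
    (hm : G.Adj y m) (hmo : m ∈ openBranch G y x)
    (hagree : ∀ e ∈ branchEdges G y m, s e = baseScenario lo hi x y e)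
    (hu : IsSortedArrangement ρ (baseScenario lo hi x y) x y u) {t : ℕ}
    (ht : t ∈ Set.Icc 1 (branchDeg G x y))
    (hcall : callTime ρ (nbrs G y m) (branchValue ρ (gammaScenario lo hi s x y u t) y) =
      t * ρ + branchValue ρ (baseScenario lo hi x y) y (u t))
    (hins : callTime ρ (insert m (nbrs G y m))
        (branchValue ρ (gammaScenario lo hi s x y u t) y) ≤
      callTime ρ (insert m (nbrs G y m)) (branchValue ρ s y) +
        (callTime ρ (nbrs G y m) (branchValue ρ (gammaScenario lo hi s x y u t) y) -
          callTime ρ (nbrs G y m) (branchValue ρ s y))) :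
    criterion ρ s x y ≤ criterion ρ (betaScenario lo hi x y u t) x y := by
  have hs0 := nonneg_of_mem_scenarios hlo hs
  have hα0 := nonneg_of_mem_scenarios hlo (baseScenario_mem hlohi x y)
  have hγ0 := nonneg_of_mem_scenarios hlo (gammaScenario_mem hlohi hs x y u t)
  have hβ0 := nonneg_of_mem_scenarios hlo (betaScenario_mem hlohi x y u t)
  have hN := branchNbrs_eq hG hm hmo
  have hbij : Set.BijOn u (Set.Icc 1 (branchDeg G x y)) (nbrs G y m) := hN ▸ hu.1
  have hβm : ∀ e ∈ branchEdges G y m, betaScenario lo hi x y u t e = s e := fun e he => by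
    rw [betaScenario_apply_toward hG hm hmo hu.1 he, hagree e he]
  have hβlow : ∀ i ∈ Set.Icc 1 t, branchValue ρ (betaScenario lo hi x y u t) y (u i) =
      branchValue ρ (baseScenario lo hi x y) y (u i) := by
    intro i hi
    have hi' : i ∈ Set.Icc 1 (branchDeg G x y) := ⟨hi.1, hi.2.trans ht.2⟩
    refine branchValue_congr hG hρ hα0 hβ0 (hu.1.mapsTo hi').1 fun e he => ?_
    rw [betaScenario_apply_index hG hu.1 hi' he, if_neg (by have := hi.2; omega)]
  -- The first `t` branches keep their raised values, all at least that of `u t`. They alone retain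
  -- the closed-branch time reached under `γ^t`.
  have h1 : t * ρ + branchValue ρ (baseScenario lo hi x y) y (u t) ≤
      callTime ρ (nbrs G y m) (branchValue ρ (betaScenario lo hi x y u t) y) := by
    refine mul_add_le_callTime_of_prefix hρ.le hbij ht fun i hi => ?_
    rw [hβlow i hi]
    exact hu.2 ⟨hi.1, hi.2.trans ht.2⟩ ht hi.2
  have h2 : callTime ρ (insert m (nbrs G y m)) (branchValue ρ (betaScenario lo hi x y u t) y) ≤
      callTime ρ (insert m (nbrs G y m)) (branchValue ρ (gammaScenario lo hi s x y u t) y) := by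
    refine callTime_mono hρ.le subset_rfl fun v hv => ?_
    rcases Finset.mem_insert.1 hv with rfl | hv
    · refine branchValue_mono hG hρ hγ0 hβ0 hm fun e he => ?_
      rw [hβm e he, gammaScenario_apply_toward hG hm hmo hu.1 ht.2 he]
    · obtain ⟨k, hk, rfl⟩ := hbij.surjOn hv
      refine branchValue_mono hG hρ hγ0 hβ0 (hu.1.mapsTo hk).1 fun e he => ?_
      rw [betaScenario_apply_index hG hu.1 hk he,
        gammaScenario_apply_index hG hu.1 ht.2 hk he]
      rcases Nat.lt_or_ge t k with h | h
      · rw [if_pos h, if_neg (by omega)]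
        exact (hs e).1
      · rw [if_neg (by omega), if_pos h]
  rw [criterion_eq_callTime hG hρ hs0 hm hmo, criterion_eq_callTime hG hρ hβ0 hm hmo,
    pathCost_congr fun e he => hβm e (pathEdges_subset_branchEdges hG hm hmo he)]
  linarith

/-- The third and fourth transformations. -/
theorem third_fourth_transformation (hG : G.IsTree) (hρ : 0 < ρ) (hlo : ∀ e, 0 ≤ lo e)
    (hlohi : ∀ e, lo e ≤ hi e) (hs : s ∈ scenarios lo hi)
    (hy : IsPrimeCenter ρ s y) (hx : ¬ IsPrimeCenter ρ s x)
    (hagree : ∀ e ∈ pathEdges G x y ∪ edgesIn G (openBranch G y x),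
      s e = baseScenario lo hi x y e)
    (hu : IsSortedArrangement ρ (baseScenario lo hi x y) x y u)
    (hm : G.Adj y m) (hmo : m ∈ openBranch G y x)
    {Q₀ : ℕ → V} (hQ : IsSortedArrangement ρ s x y Q₀) :
    1 ≤ branchDeg G x y ∧ ∃ τ₀, IsFirstCritical ρ s x y Q₀ τ₀ ∧
      (branchValue ρ s y (Q₀ τ₀) ≤ wt s y m + bTime ρ s m (openBranch G y x) →
        criterion ρ s x y ≤ criterion ρ (betaScenario lo hi x y u (branchDeg G x y)) x y) ∧
      (wt s y m + bTime ρ s m (openBranch G y x) < branchValue ρ s y (Q₀ τ₀) →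
        ∃ t, IsLeast {j | j ∈ Set.Icc 1 (branchDeg G x y) ∧
            IsFirstCritical ρ (gammaScenario lo hi s x y u j) x y
              (shiftSeq (branchDeg G x y) u Q₀ j) j} t ∧
          criterion ρ s x y ≤ criterion ρ (betaScenario lo hi x y u t) x y) := by
  classical
  have hs0 := nonneg_of_mem_scenarios hlo hs
  have hγ0 := fun j => nonneg_of_mem_scenarios hlo (gammaScenario_mem hlohi hs x y u j)
  have hN := branchNbrs_eq hG hm hmo
  have hQbij : Set.BijOn Q₀ (Set.Icc 1 (branchDeg G x y)) (nbrs G y m) := hN ▸ hQ.1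
  have hh : 1 ≤ branchDeg G x y := by
    rw [← card_eq_of_bijOn hQbij]
    exact Finset.card_pos.2 (nbrs_nonempty hG hρ hs0 hm hmo hy hx)
  rw [pathEdges_union_edgesIn hG hm hmo] at hagree
  have H := isRaising_gamma (s := s) hG hρ hlo hlohi hs hm hmo hu
  obtain ⟨τ₀, hτ⟩ := exists_isLeast_nat (S := {k | k ∈ Set.Icc 1 (branchDeg G x y) ∧
      bTime ρ s y (closedBranch G y x) = k * ρ + branchValue ρ s y (Q₀ k)}) (by
    obtain ⟨k, hk, he⟩ := exists_callTime_eq_position hρ.le hQbij hQ.2 hh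
      fun v hv => branchValue_nonneg hG hρ hs0 (mem_nbrs.1 hv).1
    exact ⟨k, hk, (bTime_branch hG hρ hs0 hm hmo).trans he⟩)
  -- The critical set under `s`: the first `τ₀` entries of `Q₀`, with threshold `φ` the value at
  -- position `τ₀`.
  obtain ⟨A, hA, hAne, hAcard, hAφ⟩ := exists_prefix (f := branchValue ρ s y)
    (θ := branchValue ρ s y (Q₀ τ₀)) hQbij hτ.1.1 fun i hi =>
      hQ.2 ⟨hi.1, hi.2.trans hτ.1.1.2⟩ hτ.1.1 hi.2
  have hcrit : callTime ρ (nbrs G y m) (branchValue ρ s y) =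
      A.card * ρ + branchValue ρ s y (Q₀ τ₀) := by
    rw [hAcard, ← bTime_branch hG hρ hs0 hm hmo]
    exact hτ.1.2
  refine ⟨hh, τ₀, hτ, ?_, ?_⟩
  · rw [branchValue_openBranch hG hm hmo, betaScenario_branchDeg]
    exact criterion_le_criterion_base hG hρ hlo hlohi hs hm hmo hagree hA hAφ hcrit
  · rw [branchValue_openBranch hG hm hmo]
    intro hlt
    obtain ⟨t, ht, hcall, hbefore⟩ := H.exists_isLeast hρ.le hh hQbij (by
      simp only [gammaScenario_zero]
      exact hQ.2)
    refine ⟨t, ?_, ?_⟩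
    · simp only [IsFirstCritical, fun j => bTime_branch hG hρ (hγ0 j) hm hmo]
      exact ht
    · have hmt : branchValue ρ (gammaScenario lo hi s x y u t) y m = branchValue ρ s y m :=
        branchValue_congr hG hρ hs0 (hγ0 t) hm fun e he =>
          gammaScenario_apply_toward hG hm hmo hu.1 ht.1.1.2 he
      have hins := H.callTime_insert_le (A := A) (φ := branchValue ρ s y (Q₀ τ₀)) (m := m)
        hρ.le ht.1.1 hbefore hA hAne
      simp only [gammaScenario_zero] at hins
      exact criterion_le_criterion_beta hG hρ hlo hlohi hs hm hmo hagree hu ht.1.1 hcall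
        (hins hAφ hcrit.le hmt hlt)

end Branches

/-! ### Counting the candidate scenarios -/

section Candidates

variable {V : Type*} {G : SimpleGraph V} {ρ : ℝ} {lo hi : Weights G}

/-- The pairs `(y, j)` that index the modified base scenarios. -/
def candidateIndices (G : SimpleGraph V) (x : V) : Set (V × ℕ) :=
  {p | p.1 ≠ x ∧ p.2 ∈ Set.Icc 1 (branchDeg G x p.1)}

lemma candidates_eq (x : V) (u : V → ℕ → V) (c : Weights G) : candidates lo hi x u c =
    insert c ((fun p : V × ℕ => betaScenario lo hi x p.1 (u p.1) p.2) ''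
      candidateIndices G x) := by
  ext s
  constructor
  · rintro (h | ⟨y, hy, j, hj, h⟩)
    · exact Or.inl h
    · exact Or.inr ⟨(y, j), ⟨hy, hj⟩, h.symm⟩
  · rintro (h | ⟨p, ⟨hy, hj⟩, h⟩)
    · exact Or.inl h
    · exact Or.inr ⟨p.1, hy, p.2, hj, h.symm⟩

/-- The vertex `u y j` determines `y`, its unique neighbour toward `x`, and then `j`. -/
lemma injOn_candidateIndices (hG : G.IsTree) {x : V} {u : V → ℕ → V}
    (hu : ∀ y, y ≠ x → Set.BijOn (u y) (Set.Icc 1 (branchDeg G x y)) (branchNbrs G x y)) :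
    Set.InjOn (fun p : V × ℕ => u p.1 p.2) (candidateIndices G x) := by
  rintro ⟨y, j⟩ ⟨hy, hj⟩ ⟨z, i⟩ ⟨hz, hi⟩ h
  simp only at h hy hj hz hi
  have h1 := (hu y hy).mapsTo hj
  have h2 := (hu z hz).mapsTo hi
  have h3 := (mem_closedBranch_adj_iff hG h1.1).1 h1.2
  have h4 := (mem_closedBranch_adj_iff hG h2.1).1 h2.2
  rw [← h] at h4
  have h5 := h2.1
  rw [← h] at h5
  obtain rfl : y = z := parent_unique hG h1.1.symm h5.symm h3 h4
  rw [(hu y hy).injOn hj hi h]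

variable [Fintype V]

lemma exists_isSortedArrangement (ρ : ℝ) (s : Weights G) (x y : V) :
    ∃ q, IsSortedArrangement ρ s x y q := by
  classical
  let N := (branchNbrs G x y).toFinset
  have hN : (N : Set V) = branchNbrs G x y := by simp [N]
  have hcard : N.card = branchDeg G x y := by
    rw [branchDeg, ← hN, Set.ncard_coe_finset]
  let l := N.toList.mergeSort fun v w => decide (branchValue ρ s y w ≤ branchValue ρ s y v)
  have hperm : l.Perm N.toList := List.mergeSort_perm _ _
  have hlen : l.length = branchDeg G x y := by
    rw [hperm.length_eq, Finset.length_toList, hcard]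
  have hnodup : l.Nodup := hperm.nodup_iff.2 N.nodup_toList
  have hsorted : l.Pairwise fun v w => branchValue ρ s y w ≤ branchValue ρ s y v := by
    have := List.pairwise_mergeSort
      (le := fun v w => decide (branchValue ρ s y w ≤ branchValue ρ s y v))
      (fun a b c h1 h2 => by
        simp only [decide_eq_true_eq] at *
        exact h2.trans h1)
      (fun a b => by
        simp only [Bool.or_eq_true, decide_eq_true_eq]
        exact le_total _ _) N.toList
    simpa using this
  have hget : ∀ k ∈ Set.Icc 1 (branchDeg G x y), ∃ h : k - 1 < l.length,
      l.getD (k - 1) y = l[k - 1] := by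
    intro k hk
    have h : k - 1 < l.length := by
      have := hk.1
      have := hk.2
      omega
    exact ⟨h, List.getD_eq_getElem _ _ h⟩
  refine ⟨fun k => l.getD (k - 1) y, ⟨?_, ?_, ?_⟩, ?_⟩
  · intro k hk
    obtain ⟨h, he⟩ := hget k hk
    simp only
    rw [he, ← hN, Finset.mem_coe, ← Finset.mem_toList, ← hperm.mem_iff]
    exact List.getElem_mem h
  · intro k hk i hi hki
    obtain ⟨h, he⟩ := hget k hk
    obtain ⟨h', he'⟩ := hget i hi
    simp only at hki
    rw [he, he', hnodup.getElem_inj_iff] at hki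
    have := hk.1
    have := hi.1
    omega
  · intro v hv
    rw [← hN, Finset.mem_coe, ← Finset.mem_toList, ← hperm.mem_iff] at hv
    obtain ⟨i, hi, rfl⟩ := List.getElem_of_mem hv
    refine ⟨i + 1, ⟨by omega, by omega⟩, ?_⟩
    simp only [Nat.add_sub_cancel]
    exact List.getD_eq_getElem _ _ hi
  · intro k hk i hi hki
    obtain ⟨h, he⟩ := hget k hk
    obtain ⟨h', he'⟩ := hget i hi
    simp only
    rw [he, he']
    rcases hki.eq_or_lt with rfl | hlt
    · exact le_rfl
    · have := hk.1
      exact List.pairwise_iff_getElem.1 hsorted _ _ h h' (by omega)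

lemma finite_candidateIndices (hG : G.IsTree) {x : V} {u : V → ℕ → V}
    (hu : ∀ y, y ≠ x → Set.BijOn (u y) (Set.Icc 1 (branchDeg G x y)) (branchNbrs G x y)) :
    (candidateIndices G x).Finite :=
  Set.Finite.of_injOn (Set.mapsTo_univ _ _) (injOn_candidateIndices hG hu) Set.finite_univ

/-- The vertices `u y j` with `y ≠ x` lie at distance at least two from `x`, so they miss `x` and a
neighbour of `x`. This leaves room for `c` in the bound `n - 1`. -/
lemma ncard_candidateIndices_le (hG : G.IsTree) {x : V} {u : V → ℕ → V}
    (hu : ∀ y, y ≠ x → Set.BijOn (u y) (Set.Icc 1 (branchDeg G x y)) (branchNbrs G x y))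
    (hV : 2 ≤ Fintype.card V) : (candidateIndices G x).ncard ≤ Fintype.card V - 2 := by
  classical
  obtain ⟨z, hz⟩ := Fintype.exists_ne_of_one_lt_card (show 1 < Fintype.card V by omega) x
  obtain ⟨v, hv, -⟩ := exists_parent hG hz.symm
  have h1 : ∀ p ∈ candidateIndices G x, u p.1 p.2 ∈ ({x, v}ᶜ : Set V) := by
    rintro ⟨y, j⟩ ⟨hy, hj⟩ h
    simp only at h hy hj
    have h1 := (hu y hy).mapsTo hj
    have h3 := (mem_closedBranch_adj_iff hG h1.1).1 h1.2
    have h4 := hG.connected.pos_dist_of_ne hy.symm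
    rcases h with h | h
    · rw [h, SimpleGraph.dist_self] at h3
      omega
    · rw [Set.mem_singleton_iff.1 h, SimpleGraph.dist_eq_one_iff_adj.2 hv] at h3
      omega
  refine (Set.ncard_le_ncard_of_injOn _ h1 (injOn_candidateIndices hG hu)
    (Set.toFinite _)).trans ?_
  rw [Set.ncard_compl, Set.ncard_pair hv.ne, Nat.card_eq_fintype_card]

end Candidates

end Broadcast

namespace Broadcast

/-! ### Assembly of the main theorem -/

variable {V : Type*} [Fintype V] {G : SimpleGraph V} {ρ : ℝ} {lo hi : Weights G} {x : V}
  {u : V → ℕ → V}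

/-- If `x` is never a prime center in the worst case, some modified base scenario attains the
maximum regret as the value of the criterion. -/
theorem exists_betaScenario (hG : G.IsTree) (hρ : 0 < ρ) (hlo : ∀ e, 0 ≤ lo e)
    (hlohi : ∀ e, lo e ≤ hi e)
    (hu : ∀ y, y ≠ x → IsSortedArrangement ρ (baseScenario lo hi x y) x y (u y))
    (hx : ∀ s, IsWorstCase ρ lo hi x s → ¬ IsPrimeCenter ρ s x) :
    ∃ s y, IsWorstCase ρ lo hi x s ∧ IsPrimeCenter ρ s y ∧ y ≠ x ∧
      ∃ j ∈ Set.Icc 1 (branchDeg G x y),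
        regret ρ s x y ≤ criterion ρ (betaScenario lo hi x y (u y) j) x y := by
  obtain ⟨s, y, hs, hyx, hy, hagree⟩ := second_transformation hG hρ hlo hlohi hx
  obtain ⟨m, hm, hd⟩ := exists_parent hG hyx
  have hmo := (mem_openBranch_adj_iff hG hm).2 hd
  obtain ⟨Q₀, hQ⟩ := exists_isSortedArrangement ρ s x y
  obtain ⟨hh, τ₀, -, h1, h2⟩ := third_fourth_transformation hG hρ hlo hlohi hs.1 hy (hx s hs)
    hagree (hu y hyx) hm hmo hQ
  rw [criterion_eq_regret hG hρ (nonneg_of_mem_scenarios hlo hs.1) hyx hy] at h1 h2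
  refine ⟨s, y, hs, hy, hyx, ?_⟩
  rcases le_or_gt (branchValue ρ s y (Q₀ τ₀)) (wt s y m + bTime ρ s m (openBranch G y x)) with h | h
  · exact ⟨_, ⟨hh, le_rfl⟩, h1 h⟩
  · obtain ⟨t, ht, hle⟩ := h2 h
    exact ⟨t, ht.1.1, hle⟩

end Broadcast

theorem mainTheorem2 {V : Type*} [Fintype V] (G : SimpleGraph V) (hG : G.IsTree)
    (ρ : ℝ) (hρ : 0 < ρ) (lo hi : Weights G)
    (hlo : ∀ e, 0 ≤ lo e) (hlohi : ∀ e, lo e ≤ hi e) (x : V)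
    (c : Weights G) (hc : c ∈ scenarios lo hi)
    (u : V → ℕ → V)
    (hu : ∀ y, y ≠ x → IsSortedArrangement ρ (baseScenario lo hi x y) x y (u y)) :
    -- the finite family of candidate scenarios
    (candidates lo hi x u c ⊆ scenarios lo hi ∧
      (candidates lo hi x u c).Finite ∧
      (2 ≤ Fintype.card V → (candidates lo hi x u c).ncard ≤ Fintype.card V - 1) ∧
      (∃ s ∈ candidates lo hi x u c, IsWorstCase ρ lo hi x s)) ∧
    -- if `x` is optimal under some worst-case scenario, the arbitrary scenario is worst-case
    ((∃ s, IsWorstCase ρ lo hi x s ∧ IsCenter ρ s x) → IsWorstCase ρ lo hi x c) ∧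
    -- otherwise some modified base scenario is worst-case
    ((∀ s, IsWorstCase ρ lo hi x s → ¬ IsPrimeCenter ρ s x) →
      ∃ y, y ≠ x ∧ (∃ s, IsWorstCase ρ lo hi x s ∧ IsPrimeCenter ρ s y) ∧
        ∃ j ∈ Set.Icc 1 (branchDeg G x y),
          IsWorstCase ρ lo hi x (betaScenario lo hi x y (u y) j)) ∧
    -- every maximizer of the criterion is a worst-case scenario
    (∀ y', y' ≠ x → ∀ j' ∈ Set.Icc 1 (branchDeg G x y'),
      (∀ y, y ≠ x → ∀ j ∈ Set.Icc 1 (branchDeg G x y),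
        criterion ρ (betaScenario lo hi x y (u y) j) x y ≤
          criterion ρ (betaScenario lo hi x y' (u y') j') x y') →
      IsWorstCase ρ lo hi x (betaScenario lo hi x y' (u y') j')) ∧
    -- first transformation
    (∀ s y, IsWorstCase ρ lo hi x s → y ≠ x → IsPrimeCenter ρ s y →
      ∀ s' : Weights G,
        (∀ e ∈ pathEdges G x y ∪ edgesIn G (openBranch G y x),
          s' e = baseScenario lo hi x y e) →
        (∀ e, e ∉ pathEdges G x y ∪ edgesIn G (openBranch G y x) → s' e = s e) →
        IsWorstCase ρ lo hi x s' ∧ IsCenter ρ s' y) ∧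
    -- second transformation
    ((∀ s, IsWorstCase ρ lo hi x s → ¬ IsPrimeCenter ρ s x) →
      ∃ s y, IsWorstCase ρ lo hi x s ∧ y ≠ x ∧ IsPrimeCenter ρ s y ∧
        ∀ e ∈ pathEdges G x y ∪ edgesIn G (openBranch G y x),
          s e = baseScenario lo hi x y e) ∧
    -- third and fourth transformations
    ((∀ s, IsWorstCase ρ lo hi x s → ¬ IsPrimeCenter ρ s x) →
      ∀ s y, IsWorstCase ρ lo hi x s → IsPrimeCenter ρ s y →
        (∀ e ∈ pathEdges G x y ∪ edgesIn G (openBranch G y x),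
          s e = baseScenario lo hi x y e) →
        ∀ μ, G.Adj y μ → μ ∈ openBranch G y x →
        ∀ Q₀ : ℕ → V, IsSortedArrangement ρ s x y Q₀ →
        ∃ τ₀, IsFirstCritical ρ s x y Q₀ τ₀ ∧
          (branchValue ρ s y (Q₀ τ₀) ≤ wt s y μ + bTime ρ s μ (openBranch G y x) →
            IsWorstCase ρ lo hi x (betaScenario lo hi x y (u y) (branchDeg G x y))) ∧
          (wt s y μ + bTime ρ s μ (openBranch G y x) < branchValue ρ s y (Q₀ τ₀) →
            ∃ t, IsLeast {j | j ∈ Set.Icc 1 (branchDeg G x y) ∧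
                IsFirstCritical ρ (gammaScenario lo hi s x y (u y) j) x y
                  (shiftSeq (branchDeg G x y) (u y) Q₀ j) j} t ∧
              IsWorstCase ρ lo hi x (betaScenario lo hi x y (u y) t))) := by
  classical
  -- Since `criterion` never exceeds the regret, it is enough that its value under `s'` reaches the
  -- maximum regret; nothing about centers under `s'` is needed.
  have worst_of_le : ∀ {s : Weights G} {y : V}, IsWorstCase ρ lo hi x s → IsCenter ρ s y →
      ∀ {s' : Weights G} {z : V}, s' ∈ scenarios lo hi → regret ρ s x y ≤ criterion ρ s' x z →
      IsWorstCase ρ lo hi x s' := fun hs hy _ z hs' hle =>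
    isWorstCase_of_le (y := z) (hs.isGreatest hy) hs'
      (hle.trans (criterion_le_regret hG hρ (nonneg_of_mem_scenarios hlo hs') x z))
  have center : (∃ s, IsWorstCase ρ lo hi x s ∧ IsCenter ρ s x) →
      ∀ s' ∈ scenarios lo hi, IsWorstCase ρ lo hi x s' := by
    rintro ⟨s, hs, hx⟩ s' hs'
    exact isWorstCase_of_isCenter hs hx hs'
  have hβ := fun y j => betaScenario_mem hlohi x y (u y) j
  have main : (∀ s, IsWorstCase ρ lo hi x s → ¬ IsPrimeCenter ρ s x) →
      ∃ y, y ≠ x ∧ (∃ s, IsWorstCase ρ lo hi x s ∧ IsPrimeCenter ρ s y) ∧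
        ∃ j ∈ Set.Icc 1 (branchDeg G x y),
          IsWorstCase ρ lo hi x (betaScenario lo hi x y (u y) j) := by
    intro hx
    obtain ⟨s, y, hs, hy, hyx, j, hj, hle⟩ := exists_betaScenario hG hρ hlo hlohi hu hx
    exact ⟨y, hyx, ⟨s, hs, hy⟩, j, hj, worst_of_le hs hy.1 (hβ y j) hle⟩
  have hbij := fun y hy => (hu y hy).1
  refine ⟨⟨?_, ?_, fun hV => ?_, ?_⟩, fun h => center h c hc, main, ?_, ?_,
    second_transformation hG hρ hlo hlohi, ?_⟩
  · rintro s (rfl | ⟨y, -, j, -, rfl⟩)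
    · exact hc
    · exact hβ y j
  · rw [candidates_eq]
    exact ((finite_candidateIndices hG hbij).image _).insert _
  · rw [candidates_eq]
    refine (Set.ncard_insert_le _ _).trans ?_
    have h1 := Set.ncard_image_le (f := fun p : V × ℕ => betaScenario lo hi x p.1 (u p.1) p.2)
      (finite_candidateIndices hG hbij)
    have h2 := ncard_candidateIndices_le hG hbij hV
    omega
  · by_cases hx : ∀ s, IsWorstCase ρ lo hi x s → ¬ IsPrimeCenter ρ s x
    · obtain ⟨y, hyx, -, j, hj, hw⟩ := main hx
      exact ⟨_, Or.inr ⟨y, hyx, j, hj, rfl⟩, hw⟩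
    · push Not at hx
      obtain ⟨s, hs, hsx⟩ := hx
      exact ⟨c, Or.inl rfl, center ⟨s, hs, hsx.1⟩ c hc⟩
  · intro y' hy' j' hj' hmax
    -- Under `(*)` some candidate has criterion at least the maximum regret, hence so has any
    -- maximizer. Otherwise `x` is a center in a worst case and every scenario is worst-case.
    by_cases hx : ∀ s, IsWorstCase ρ lo hi x s → ¬ IsPrimeCenter ρ s x
    · obtain ⟨s, y, hs, hy, hyx, j, hj, hle⟩ := exists_betaScenario hG hρ hlo hlohi hu hx
      exact worst_of_le hs hy.1 (hβ y' j') (hle.trans (hmax y hyx j hj))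
    · push Not at hx
      obtain ⟨s, hs, hsx⟩ := hx
      exact center ⟨s, hs, hsx.1⟩ _ (hβ y' j')
  · intro s y hs hyx hy s' h1 h2
    exact first_transformation hG hρ hlo hlohi hs hyx hy h1 h2
  · intro hx s y hs hy hagree m hm hmo Q₀ hQ
    have hyx : y ≠ x := by
      rintro rfl
      exact hx s hs hy
    obtain ⟨-, τ₀, hτ, h1, h2⟩ := third_fourth_transformation hG hρ hlo hlohi hs.1 hy (hx s hs)
      hagree (hu y hyx) hm hmo hQ
    rw [criterion_eq_regret hG hρ (nonneg_of_mem_scenarios hlo hs.1) hyx hy] at h1 h2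
    refine ⟨τ₀, hτ, fun h => worst_of_le hs hy.1 (hβ y _) (h1 h), fun h => ?_⟩
    obtain ⟨t, ht, hle⟩ := h2 h
    exact ⟨t, ht, worst_of_le hs hy.1 (hβ y t) hle⟩
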